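/- Let $X$ be a locally path-connected, semi-locally simply connected (possibly disconnected) topological space whose first singular homology group $H_1(X)=H_1(X;\mathbb Z)$ is free abelian of finite rank. Let $h:X\to X$ be a homeomorphism and $\rho:H_1(X)\to\mathbb Z$ a homomorphism with $\rho h_*=\rho$. Let $p:X^{(\infty)}\to X$ be the (possibly disconnected) covering space associated to $\rho$: a group $\mathbb Z=\langle T\rangle$ acts on $X^{(\infty)}$ by deck transformations, freely, properly discontinuously and transitively on each fibre, and the monodromy along a loop $\gamma$ is $T^{\rho([\gamma])}$. Let $h^{(\infty)}$ be a lift of $h$ to a homeomorphism of $X^{(\infty)}$ commuting with $T$. For an integer $k>0$ let $X^{(k)}=X^{(\infty)}/T^k$, let $q^{(k)}:X^{(\infty)}\to X^{(k)}$ be the projection, and let $h^{(k)}:X^{(k)}\to X^{(k)}$ be the lift of $h$ induced by $h^{(\infty)}$. Put $S^{(k)}_{\mathbb C}=q^{(k)}_*\big(H_1(X^{(\infty)};\mathbb C)\big)\subset H_1(X^{(k)};\mathbb C)$, $R=\mathbb Z[t^{\pm1}]$ and $\eta_k=e^{2\pi i/k}$, and regard $H_1(X^{(\infty)})$ as an $R$-module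 with $t$ acting as $T_*$. Then $S^{(k)}_{\mathbb C}$ is invariant under $h^{(k)}_*$, and the following hold. 1. Suppose that $H_1(X^{(\infty)})$ is a free $R$-module of finite rank $r$, and let $M=M(t)$ be the matrix of the $R$-linear map $h^{(\infty)}_*$ in an $R$-basis of $H_1(X^{(\infty)})$. Then $M\in GL(r,R)$, and in a suitable basis of $S^{(k)}_{\mathbb C}$ the action of $h^{(k)}_*$ on $S^{(k)}_{\mathbb C}$ is given by the block-diagonal matrix $$M(1)\oplus M(\eta_k)\oplus\cdots\oplus M(\eta_k^{k-1}),$$ where $M(\eta_k^j)$ is the complex matrix obtained by substituting $\eta_k^j$ for $t$ in $M$. 2. If $v\in H_1(X^{(k)};\mathbb C)$ is an eigenvector of $h^{(k)}_*$ with $v\notin S^{(k)}_{\mathbb C}$, then its eigenvalue is a root of unity. Moreover, every eigenvalue of the map induced by $h^{(k)}_*$ on $H_1(X^{(k)};\mathbb C)/S^{(k)}_{\mathbb C}$ is a root of unity. -/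

import Mathlib

open CategoryTheory AlgebraicTopology Simplicial Topology
open scoped LaurentPolynomial

universe u

noncomputable section

namespace CyclicCover

/-! ### First singular homology -/

/-- The object `H_1(X; 𝕜)`: first singular homology of `X` with coefficients in the ring `𝕜`. -/
abbrev H1Obj (𝕜 : Type) [CommRing 𝕜] (X : Type u) [TopologicalSpace X] : ModuleCat.{u} 𝕜 :=
  ((singularHomologyFunctor (ModuleCat.{u} 𝕜) 1).obj
    (ModuleCat.of 𝕜 (ULift.{u} 𝕜))).obj (TopCat.of X)

/-- `H_1(X; 𝕜)` as a type. -/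
def H1 (𝕜 : Type) [CommRing 𝕜] (X : Type u) [TopologicalSpace X] : Type u := H1Obj 𝕜 X

instance (𝕜 : Type) [CommRing 𝕜] (X : Type u) [TopologicalSpace X] : AddCommGroup (H1 𝕜 X) :=
  inferInstanceAs (AddCommGroup (H1Obj 𝕜 X))

instance (𝕜 : Type) [CommRing 𝕜] (X : Type u) [TopologicalSpace X] : Module 𝕜 (H1 𝕜 X) :=
  inferInstanceAs (Module 𝕜 (H1Obj 𝕜 X))

/-- The map `f_* : H_1(X; 𝕜) → H_1(Y; 𝕜)` induced by a continuous map `f`. -/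
def h1Map (𝕜 : Type) [CommRing 𝕜] {X Y : Type u} [TopologicalSpace X] [TopologicalSpace Y]
    (f : C(X, Y)) : H1 𝕜 X →ₗ[𝕜] H1 𝕜 Y :=
  (((singularHomologyFunctor (ModuleCat.{u} 𝕜) 1).obj
    (ModuleCat.of 𝕜 (ULift.{u} 𝕜))).map (TopCat.ofHom f)).hom

theorem h1Map_id (𝕜 : Type) [CommRing 𝕜] (X : Type u) [TopologicalSpace X] :
    h1Map 𝕜 (ContinuousMap.id X) = LinearMap.id := by
  unfold h1Map
  rw [TopCat.ofHom_id, CategoryTheory.Functor.map_id]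
  rfl

theorem h1Map_comp (𝕜 : Type) [CommRing 𝕜] {X Y Z : Type u} [TopologicalSpace X]
    [TopologicalSpace Y] [TopologicalSpace Z] (g : C(Y, Z)) (f : C(X, Y)) :
    h1Map 𝕜 (g.comp f) = (h1Map 𝕜 g).comp (h1Map 𝕜 f) := by
  unfold h1Map
  rw [TopCat.ofHom_comp, CategoryTheory.Functor.map_comp]
  rfl

/-! ### The homology class of a loop -/

section Loop

variable {X : Type u} [TopologicalSpace X]

/-- The path `γ`, reparametrized as a map on the standard `1`-simplex: `(s₀, s₁) ↦ γ s₁`. -/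
def pathOnSimplex {x y : X} (γ : Path x y) : C(stdSimplex ℝ (Fin 2), X) where
  toFun s := γ ⟨s.1 1, s.2.1 1, by
    have h := s.2.2
    have h0 := s.2.1 0
    rw [Fin.sum_univ_two] at h
    linarith⟩
  continuous_toFun := by
    refine γ.continuous.comp (Continuous.subtype_mk ?_ _)
    exact (continuous_apply (1 : Fin 2)).comp continuous_subtype_val

/-- The singular `1`-simplex given by a path. -/
def pathSimplex {x y : X} (γ : Path x y) : (TopCat.toSSet.obj (TopCat.of X)) _⦋1⦌ :=
  (TopCat.toSSetObjEquiv (TopCat.of X) (.op ⦋1⦌)).symm (pathOnSimplex γ)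

theorem pathSimplex_face {x y : X} (γ : Path x y) (i : Fin 2) (s : stdSimplex ℝ (Fin 1)) :
    TopCat.toSSetObjEquiv (TopCat.of X) (.op ⦋0⦌)
      ((TopCat.toSSet.obj (TopCat.of X)).δ i (pathSimplex γ)) s =
      pathOnSimplex γ (stdSimplex.map (SimplexCategory.δ i).toOrderHom s) := by
  rfl

theorem pathSimplex_boundary {x : X} (γ : Path x x) :
    (TopCat.toSSet.obj (TopCat.of X)).δ 0 (pathSimplex γ) =
      (TopCat.toSSet.obj (TopCat.of X)).δ 1 (pathSimplex γ) := by
  apply (TopCat.toSSetObjEquiv (TopCat.of X) (.op ⦋0⦌)).injective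
  ext s
  have hs : s = stdSimplex.vertex (0 : Fin 1) := Subsingleton.elim _ _
  have h0 : stdSimplex.map (S := ℝ) (SimplexCategory.δ (0 : Fin 2)).toOrderHom
      (stdSimplex.vertex (0 : Fin 1)) = stdSimplex.vertex (1 : Fin 2) :=
    stdSimplex.map_vertex _ _
  have h1 : stdSimplex.map (S := ℝ) (SimplexCategory.δ (1 : Fin 2)).toOrderHom
      (stdSimplex.vertex (0 : Fin 1)) = stdSimplex.vertex (0 : Fin 2) :=
    stdSimplex.map_vertex _ _
  have e1 : pathOnSimplex γ (stdSimplex.vertex (1 : Fin 2)) = x := by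
    simp [pathOnSimplex, stdSimplex.vertex]
  have e0 : pathOnSimplex γ (stdSimplex.vertex (0 : Fin 2)) = x := by
    simp [pathOnSimplex, stdSimplex.vertex]
  calc _ = pathOnSimplex γ (stdSimplex.vertex (1 : Fin 2)) := by
        rw [pathSimplex_face, hs]; exact congrArg _ h0
    _ = pathOnSimplex γ (stdSimplex.vertex (0 : Fin 2)) := by rw [e1, e0]
    _ = _ := by
        rw [pathSimplex_face, hs]; exact congrArg _ h1.symm

theorem pathSimplex_cycle (𝕜 : Type) [CommRing 𝕜] {x : X} (γ : Path x x) :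
    (TopCat.toSSet.obj (TopCat.of X)).ιChainComplex
        (R := ModuleCat.of 𝕜 (ULift.{u} 𝕜)) (pathSimplex γ) ≫
      ((TopCat.toSSet.obj (TopCat.of X)).chainComplex (ModuleCat.of 𝕜 (ULift.{u} 𝕜))).d 1 0 = 0 := by
  rw [SSet.ιChainComplex_d, Fin.sum_univ_two, pathSimplex_boundary]
  simp

/-- The Hurewicz class in `H_1(X; 𝕜)` of a loop `γ`: the class of the singular `1`-cycle
`1 · γ`. -/
def loopClass (𝕜 : Type) [CommRing 𝕜] {x : X} (γ : Path x x) : H1 𝕜 X :=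
  ((((TopCat.toSSet.obj (TopCat.of X)).chainComplex
        (ModuleCat.of 𝕜 (ULift.{u} 𝕜))).liftCycles _ 0
        (by simp) (pathSimplex_cycle 𝕜 γ)) ≫
    ((TopCat.toSSet.obj (TopCat.of X)).chainComplex
        (ModuleCat.of 𝕜 (ULift.{u} 𝕜))).homologyπ 1).hom (ULift.up 1)

end Loop

/-! ### Covering spaces associated to a homomorphism to `ℤ` -/

/-- Every point has a neighbourhood in which all loops based at that point are null-homotopic in
the whole space. -/
def SemilocallySimplyConnected (X : Type u) [TopologicalSpace X] : Prop :=
  ∀ x : X, ∃ U ∈ 𝓝 x, ∀ γ : Path x x, Set.range γ ⊆ U → γ.Homotopic (Path.refl x)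

/-- `p : E → X`, together with an action of `ℤ` on `E`, is the (possibly disconnected) covering
space of `X` associated to `ρ : H_1(X) → ℤ`: the group `ℤ` acts by deck transformations, freely,
properly discontinuously and transitively on each fibre, and the monodromy of `p` along a loop `γ`
is translation by `ρ [γ]`. -/
structure IsCoverAssociatedTo {X E : Type u} [TopologicalSpace X] [TopologicalSpace E]
    [AddAction ℤ E] (p : E → X) (ρ : H1 ℤ X →+ ℤ) : Prop
    extends IsAddQuotientCoveringMap p ℤ where
  monodromy : ∀ (e : E) (γ : Path (p e) (p e)) (n : ℤ) (δ : Path e (n +ᵥ e)),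
    (∀ t, p (δ t) = γ t) → ρ (loopClass ℤ γ) = n

section Deck

variable (E : Type u) [TopologicalSpace E] [AddAction ℤ E] [ContinuousConstVAdd ℤ E]

/-- The deck transformation `T ^ n`. -/
def deck (n : ℤ) : C(E, E) := ⟨fun e => n +ᵥ e, continuous_const_vadd n⟩

/-- The action of the deck group `ℤ` on `H_1(E)`. -/
def deckHom : Multiplicative ℤ →* AddMonoid.End (H1 ℤ E) where
  toFun n := (h1Map ℤ (deck E n.toAdd)).toAddMonoidHom
  map_one' := by
    rw [show deck E (Multiplicative.toAdd 1) = ContinuousMap.id E by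
      ext e; exact zero_vadd ℤ e, h1Map_id]
    rfl
  map_mul' m n := by
    rw [show deck E (Multiplicative.toAdd (m * n)) = (deck E m.toAdd).comp (deck E n.toAdd) by
      ext e; exact add_vadd m.toAdd n.toAdd e, h1Map_comp]
    rfl

/-- The resulting action of the ring `R = ℤ[t, t⁻¹]` on `H_1(E)`. -/
def laurentAction : ℤ[T;T⁻¹] →+* AddMonoid.End (H1 ℤ E) :=
  (AddMonoidAlgebra.lift ℤ (AddMonoid.End (H1 ℤ E)) ℤ (deckHom E)).toRingHom

/-- `H_1(E)` as a module over `R = ℤ[t, t⁻¹]`, where `t` acts as `T_*`. -/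
instance laurentModule : Module ℤ[T;T⁻¹] (H1 ℤ E) := Module.compHom _ (laurentAction E)

variable {E}

theorem laurent_smul_def (a : ℤ[T;T⁻¹]) (v : H1 ℤ E) : a • v = laurentAction E a v := rfl

theorem T_smul (n : ℤ) (v : H1 ℤ E) :
    (LaurentPolynomial.T n : ℤ[T;T⁻¹]) • v = h1Map ℤ (deck E n) v := by
  have h : laurentAction E (LaurentPolynomial.T n) = deckHom E (Multiplicative.ofAdd n) :=
    (AddMonoidAlgebra.lift_single (deckHom E) n 1).trans (one_smul ℤ _)
  rw [laurent_smul_def, h]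
  rfl

theorem laurentAction_comm {f : C(E, E)} (hf : ∀ (n : ℤ) (e : E), f (n +ᵥ e) = n +ᵥ f e)
    (a : ℤ[T;T⁻¹]) (v : H1 ℤ E) : h1Map ℤ f (a • v) = a • h1Map ℤ f v := by
  induction a using LaurentPolynomial.induction_on' with
  | add p q hp hq => rw [add_smul, map_add, hp, hq, add_smul]
  | C_mul_T n c =>
    rw [mul_smul, mul_smul, T_smul, T_smul]
    have hC : ∀ w : H1 ℤ E, (LaurentPolynomial.C c : ℤ[T;T⁻¹]) • w = c • w := fun w => by
      rw [eq_intCast LaurentPolynomial.C c, Int.cast_smul_eq_zsmul]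
    rw [hC, hC, map_zsmul, ← LinearMap.comp_apply, ← LinearMap.comp_apply, ← h1Map_comp,
      ← h1Map_comp]
    congr 3
    ext e
    exact hf n e

/-- The `R`-linear endomorphism `f_*` of `H_1(E)`, for a map `f` commuting with the deck group. -/
def h1MapLaurent (f : C(E, E)) (hf : ∀ (n : ℤ) (e : E), f (n +ᵥ e) = n +ᵥ f e) :
    H1 ℤ E →ₗ[ℤ[T;T⁻¹]] H1 ℤ E where
  toFun := h1Map ℤ f
  map_add' := map_add _
  map_smul' := laurentAction_comm hf

/-- The finite cyclic cover `E / T ^ k`. -/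
abbrev CyclicQuotient (k : ℕ) (E : Type u) [AddAction ℤ E] : Type u :=
  Quotient (AddAction.orbitRel (AddSubgroup.zmultiples (k : ℤ)) E)

/-- The covering projection `q : E → E / T ^ k`. -/
def proj (k : ℕ) (E : Type u) [TopologicalSpace E] [AddAction ℤ E] : C(E, CyclicQuotient k E) :=
  ⟨Quotient.mk _, continuous_quotient_mk'⟩

/-- The map `E / T ^ k → E / T ^ k` to which a map `f` commuting with the deck group descends. -/
def descend (k : ℕ) (f : C(E, E)) (hf : ∀ (n : ℤ) (e : E), f (n +ᵥ e) = n +ᵥ f e) :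
    C(CyclicQuotient k E, CyclicQuotient k E) where
  toFun := Quotient.map f (by
    rintro _ b ⟨n, rfl⟩
    exact ⟨n, (hf n b).symm⟩)
  continuous_toFun := f.continuous.quotient_map' _

end Deck

/-- The subspace `q_* (H_1(E; ℂ))` of `H_1(E / T ^ k; ℂ)`. -/
def liftedSubspace (k : ℕ) (E : Type u) [TopologicalSpace E] [AddAction ℤ E] :
    Submodule ℂ (H1 ℂ (CyclicQuotient k E)) :=
  LinearMap.range (h1Map ℂ (proj k E))

/-- The root of unity `η_k = e ^ (2 π i / k)`, as a unit of `ℂ`. -/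
def eta (k : ℕ) : ℂˣ := Units.mk0 (Complex.exp (2 * Real.pi * Complex.I / k)) (Complex.exp_ne_zero _)

/-- The complex matrix `M(z)` obtained from `M = M(t)` by substituting `z ≠ 0` for `t`. -/
def substitute {r : ℕ} (M : Matrix (Fin r) (Fin r) ℤ[T;T⁻¹]) (z : ℂˣ) :
    Matrix (Fin r) (Fin r) ℂ :=
  M.map (LaurentPolynomial.eval₂ (Int.castRingHom ℂ) z)

end CyclicCover

end

noncomputable section

namespace CyclicCover

/-! ### Simplicial chains as finitely supported functions -/

section Chains

variable (R : Type) [CommRing R]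

/-! Singular simplices lift through `E → E / T ^ k`, two lifts differ by a power of `T ^ k`, and the
deck action is free. Hence `0 → C(E) → C(E) → C(E / T ^ k) → 0`, with first map `T ^ k - 1`, is
exact on chains. Both halves of the theorem come from chasing this sequence around `H_1`. Write `S`
for the image of `q_*`.

Matrix form: by `h1Map_proj_eq_zero_iff`, `S` is `H_1(E; ℂ) / (T ^ k - 1)`. Given an `R`-basis `b`
of `H_1(E)`, the classes `T ^ n b_i` form a `ℂ`-basis of `H_1(E; ℂ)` (`linearIndependent_castH1`,
`span_range_castH1`), so `S` is `r` copies of `ℂ[t] / (t ^ k - 1)`. This splits over the `k`-th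
roots of unity `z`; on the `z`-summand `t` acts as `z`, so an `R`-linear map with matrix `M(t)` acts
as `M(z)`. The splitting is made explicit by the Fourier sums `eigenPart`: `eigenPart_smul` turns
`R`-scalars into their values at `z`, and `linearIndependent_eigenPart` and `span_eigenPart` give
the basis.

Roots of unity: `H_1(E / T ^ k) / S` embeds in the kernel of `T ^ k - 1` on `H_0(E)`. A `T ^
k`-invariant finite combination of path components is supported on components preserved by a nonzero
power of `T`. There are finitely many of these (`finite_periodicComponents`): they lie over
components of `X` carrying a loop with `ρ ≠ 0`, and such loops in distinct components are
independent in the finitely generated group `H_1(X)`. The lift of `h` permutes them, so some power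
`N > 0` fixes each one, and then the `N`-th power of the induced map is the identity modulo `S`
(`h1Map_descend_sub_mem_range`). An eigenvalue seen outside `S` therefore satisfies `μ ^ N = 1`. -/

/-- The boundary of a simplicial chain. -/
def bd (S : SSet.{u}) (n : ℕ) : (S _⦋n + 1⦌ →₀ R) →ₗ[R] (S _⦋n⦌ →₀ R) :=
  Finsupp.linearCombination R fun x =>
    ∑ i : Fin (n + 2), (-1 : R) ^ i.val • Finsupp.single (S.δ i x) 1

theorem bd_single (S : SSet.{u}) (n : ℕ) (x : S _⦋n + 1⦌) (a : R) :
    bd R S n (Finsupp.single x a) =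
      ∑ i : Fin (n + 2), Finsupp.single (S.δ i x) ((-1 : R) ^ i.val * a) := by
  rw [bd, Finsupp.linearCombination_single, Finset.smul_sum]
  refine Finset.sum_congr rfl fun i _ => ?_
  rw [Finsupp.smul_single, Finsupp.smul_single, smul_eq_mul, smul_eq_mul, mul_one, mul_comm]

/-- The map on simplicial chains induced by a map of simplicial sets. -/
def chainMap {S S' : SSet.{u}} (f : S ⟶ S') (n : ℕ) : (S _⦋n⦌ →₀ R) →ₗ[R] (S' _⦋n⦌ →₀ R) :=
  Finsupp.lmapDomain R R (f.app (.op ⦋n⦌))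

theorem chainMap_single {S S' : SSet.{u}} (f : S ⟶ S') (n : ℕ) (x : S _⦋n⦌) (a : R) :
    chainMap R f n (Finsupp.single x a) = Finsupp.single (f.app _ x) a := by
  simp [chainMap]

theorem bd_chainMap {S S' : SSet.{u}} (f : S ⟶ S') (n : ℕ) (c : S _⦋n + 1⦌ →₀ R) :
    bd R S' n (chainMap R f (n + 1) c) = chainMap R f n (bd R S n c) := by
  induction c using Finsupp.induction_linear with
  | zero => simp
  | add a b ha hb => simp [ha, hb]
  | single x a =>
    rw [chainMap_single, bd_single, bd_single, map_sum]
    refine Finset.sum_congr rfl fun i _ => ?_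
    rw [chainMap_single]
    congr 1
    exact (ConcreteCategory.congr_hom (f.naturality (SimplexCategory.δ i).op) x).symm

/-- Finitely supported functions on the `n`-simplices, as simplicial chains. -/
def toChain (S : SSet.{u}) (n : ℕ) :
    (S _⦋n⦌ →₀ R) →ₗ[R] ((S.chainComplex (ModuleCat.of R (ULift.{u} R))).X n : Type u) :=
  Finsupp.linearCombination R fun x =>
    (S.ιChainComplex (R := ModuleCat.of R (ULift.{u} R)) x).hom (ULift.up 1)

theorem toChain_single (S : SSet.{u}) (n : ℕ) (x : S _⦋n⦌) (a : R) :
    toChain R S n (Finsupp.single x a) =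
      (S.ιChainComplex (R := ModuleCat.of R (ULift.{u} R)) x).hom (ULift.up a) := by
  rw [toChain, Finsupp.linearCombination_single, ← map_smul]
  congr 1
  ext
  simp

/-- Simplicial chains, as finitely supported functions on the `n`-simplices. -/
def ofChain (S : SSet.{u}) (n : ℕ) :
    (S.chainComplex (ModuleCat.of R (ULift.{u} R))).X n ⟶ ModuleCat.of R (S _⦋n⦌ →₀ R) :=
  Limits.Cofan.IsColimit.desc (S.isColimitChainComplexXCofan (ModuleCat.of R (ULift.{u} R)) n)
    fun x => ModuleCat.ofHom ((Finsupp.lsingle x).comp ULift.moduleEquiv.toLinearMap)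

theorem ι_ofChain (S : SSet.{u}) (n : ℕ) (x : S _⦋n⦌) :
    S.ιChainComplex (R := ModuleCat.of R (ULift.{u} R)) x ≫ ofChain R S n =
      ModuleCat.ofHom ((Finsupp.lsingle x).comp ULift.moduleEquiv.toLinearMap) :=
  Limits.Cofan.IsColimit.fac (S.isColimitChainComplexXCofan (ModuleCat.of R (ULift.{u} R)) n) _ x

theorem ofChain_toChain (S : SSet.{u}) (n : ℕ) (c : S _⦋n⦌ →₀ R) :
    (ofChain R S n).hom (toChain R S n c) = c := by
  induction c using Finsupp.induction_linear with
  | zero => simp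
  | add a b ha hb => rw [map_add, map_add, ha, hb]
  | single x a =>
    rw [toChain_single]
    exact ConcreteCategory.congr_hom (ι_ofChain R S n x) (ULift.up a)

theorem toChain_ofChain (S : SSet.{u}) (n : ℕ)
    (c : (S.chainComplex (ModuleCat.of R (ULift.{u} R))).X n) :
    toChain R S n ((ofChain R S n).hom c) = c := by
  have : ofChain R S n ≫ ModuleCat.ofHom (toChain R S n) = 𝟙 _ := by
    refine SSet.chainComplex_hom_ext fun x => ?_
    rw [← Category.assoc, ι_ofChain, Category.comp_id]
    ext a
    exact toChain_single R S n x _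
  exact ConcreteCategory.congr_hom this c

theorem toChain_injective (S : SSet.{u}) (n : ℕ) : Function.Injective (toChain R S n) :=
  Function.LeftInverse.injective (ofChain_toChain R S n)

theorem toChain_surjective (S : SSet.{u}) (n : ℕ) : Function.Surjective (toChain R S n) :=
  Function.RightInverse.surjective (toChain_ofChain R S n)

theorem d_toChain (S : SSet.{u}) (n : ℕ) (c : S _⦋n + 1⦌ →₀ R) :
    ((S.chainComplex (ModuleCat.of R (ULift.{u} R))).d (n + 1) n).hom (toChain R S (n + 1) c) =
      toChain R S n (bd R S n c) := by
  induction c using Finsupp.induction_linear with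
  | zero => simp
  | add a b ha hb => simp only [map_add, ha, hb]
  | single x a =>
    rw [toChain_single, bd_single, map_sum]
    have h := congrArg ModuleCat.Hom.hom
      (S.ιChainComplex_d (R := ModuleCat.of R (ULift.{u} R)) x)
    rw [ModuleCat.hom_sum] at h
    refine (LinearMap.congr_fun h (ULift.up a)).trans ?_
    rw [LinearMap.sum_apply]
    refine Finset.sum_congr rfl fun i _ => ?_
    rw [toChain_single]
    rcases Nat.even_or_odd i.val with h | h
    · simp [h.neg_one_pow]
    · rw [h.neg_one_pow, h.neg_one_pow, neg_one_smul, neg_one_mul, ModuleCat.hom_neg,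
        LinearMap.neg_apply, ← map_neg]
      rfl

theorem bd_bd (S : SSet.{u}) (n : ℕ) (c : S _⦋n + 2⦌ →₀ R) :
    bd R S n (bd R S (n + 1) c) = 0 := by
  apply toChain_injective R S n
  rw [← d_toChain, ← d_toChain, map_zero]
  exact ConcreteCategory.congr_hom
    ((S.chainComplex (ModuleCat.of R (ULift.{u} R))).d_comp_d (n + 2) (n + 1) n) _

theorem f_toChain {S S' : SSet.{u}} (f : S ⟶ S') (n : ℕ) (c : S _⦋n⦌ →₀ R) :
    ((SSet.chainComplexMap f (ModuleCat.of R (ULift.{u} R))).f n).hom (toChain R S n c) =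
      toChain R S' n (chainMap R f n c) := by
  induction c using Finsupp.induction_linear with
  | zero => simp
  | add a b ha hb => simp only [map_add, ha, hb]
  | single x a =>
    rw [toChain_single, chainMap_single, toChain_single]
    exact ConcreteCategory.congr_hom
      (SSet.ι_chainComplexMap_f S S' f (ModuleCat.of R (ULift.{u} R)) x) (ULift.up a)

/-! ### Degree-one homology as cycles modulo boundaries. -/

variable (S : SSet.{u})

/-- The `1`-cycles. -/
def cycles₁ : Submodule R (S _⦋1⦌ →₀ R) := LinearMap.ker (bd R S 0)

/-- The `1`-cycles inside the chain complex of Mathlib. -/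
def cyclesToChain :
    ModuleCat.of R (cycles₁ R S) ⟶ (S.chainComplex (ModuleCat.of R (ULift.{u} R))).X 1 :=
  ModuleCat.ofHom (X := cycles₁ R S) (Y := (S.chainComplex (ModuleCat.of R (ULift.{u} R))).X 1)
    ((toChain R S 1).comp (cycles₁ R S).subtype)

theorem toChain_cycle :
    cyclesToChain R S ≫ (S.chainComplex (ModuleCat.of R (ULift.{u} R))).d 1 0 = 0 := by
  ext c
  refine (d_toChain R S 0 c.1).trans ?_
  rw [c.2, map_zero]
  rfl

/-- The homology class of a `1`-cycle. -/
def cls :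
    cycles₁ R S →ₗ[R] ((S.homology (ModuleCat.of R (ULift.{u} R)) 1 : ModuleCat.{u} R) : Type u) :=
  ((S.chainComplex (ModuleCat.of R (ULift.{u} R))).liftCycles _ 0 (by simp) (toChain_cycle R S) ≫
    (S.chainComplex (ModuleCat.of R (ULift.{u} R))).homologyπ 1).hom

theorem iCycles_injective (n : ℕ) : Function.Injective
    ((S.chainComplex (ModuleCat.of R (ULift.{u} R))).iCycles n).hom :=
  (ModuleCat.mono_iff_injective _).1 inferInstance

theorem cls_surjective : Function.Surjective (cls R S) := by
  intro v
  obtain ⟨z, rfl⟩ := (ModuleCat.epi_iff_surjective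
    ((S.chainComplex (ModuleCat.of R (ULift.{u} R))).homologyπ 1)).1 inferInstance v
  obtain ⟨c, hc⟩ := toChain_surjective R S 1
    (((S.chainComplex (ModuleCat.of R (ULift.{u} R))).iCycles 1).hom z)
  have hc0 : bd R S 0 c = 0 := by
    apply toChain_injective R S 0
    rw [← d_toChain, hc, map_zero]
    exact ConcreteCategory.congr_hom
      ((S.chainComplex (ModuleCat.of R (ULift.{u} R))).iCycles_d 1 0) z
  refine ⟨⟨c, hc0⟩, ?_⟩
  refine congrArg ((S.chainComplex (ModuleCat.of R (ULift.{u} R))).homologyπ 1).hom ?_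
  apply iCycles_injective R S 1
  refine (ConcreteCategory.congr_hom (HomologicalComplex.liftCycles_i
    (S.chainComplex (ModuleCat.of R (ULift.{u} R))) _ _ _ (toChain_cycle R S)) _).trans hc

/-- `homologyπ` is the cokernel of `toCycles`, and `iCycles` is injective, so equality of cycles can
be tested on chains. -/
theorem cls_eq_zero_iff (c : cycles₁ R S) :
    cls R S c = 0 ↔ ∃ d, bd R S 1 d = c.1 := by
  let K := S.chainComplex (ModuleCat.of R (ULift.{u} R))
  have hi : ∀ c, (K.iCycles 1).hom ((K.liftCycles _ 0 (by simp) (toChain_cycle R S)).hom c) =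
      toChain R S 1 c.1 := fun c => ConcreteCategory.congr_hom (HomologicalComplex.liftCycles_i
    K _ _ _ (toChain_cycle R S)) c
  constructor
  · intro h
    have hex : (ShortComplex.mk (K.toCycles 2 1) (K.homologyπ 1) (by simp)).Exact :=
      ShortComplex.exact_of_g_is_cokernel _ (K.homologyIsCokernel 2 1 (by simp))
    rw [ShortComplex.moduleCat_exact_iff] at hex
    obtain ⟨d, hd⟩ := hex _ h
    obtain ⟨d, rfl⟩ := toChain_surjective R S 2 d
    refine ⟨d, toChain_injective R S 1 ?_⟩
    rw [← d_toChain, ← hi, ← K.toCycles_i 2 1]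
    exact congrArg (K.iCycles 1).hom hd
  · rintro ⟨d, hd⟩
    have : (K.liftCycles _ 0 (by simp) (toChain_cycle R S)).hom c =
        (K.toCycles 2 1).hom (toChain R S 2 d) := by
      apply iCycles_injective R S 1
      rw [hi, ← hd, ← d_toChain, ← K.toCycles_i 2 1]
      rfl
    refine (congrArg (K.homologyπ 1).hom this).trans ?_
    exact ConcreteCategory.congr_hom (K.toCycles_comp_homologyπ 2 1) _

theorem homologyMap_cls {S S' : SSet.{u}} (f : S ⟶ S') (c : cycles₁ R S)
    (c' : cycles₁ R S') (h : chainMap R f 1 c.1 = c'.1) :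
    (SSet.homologyMap f (ModuleCat.of R (ULift.{u} R)) 1).hom (cls R S c) = cls R S' c' := by
  let K := S.chainComplex (ModuleCat.of R (ULift.{u} R))
  let K' := S'.chainComplex (ModuleCat.of R (ULift.{u} R))
  let φ : K ⟶ K' := SSet.chainComplexMap f (ModuleCat.of R (ULift.{u} R))
  refine (ConcreteCategory.congr_hom (HomologicalComplex.homologyπ_naturality φ 1)
    ((K.liftCycles _ 0 (by simp) (toChain_cycle R S)).hom c)).trans ?_
  refine congrArg (K'.homologyπ 1).hom ?_
  apply iCycles_injective R S' 1
  refine (ConcreteCategory.congr_hom (HomologicalComplex.cyclesMap_i φ 1)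
    ((K.liftCycles _ 0 (by simp) (toChain_cycle R S)).hom c)).trans ?_
  refine (congrArg (φ.f 1).hom (ConcreteCategory.congr_hom (HomologicalComplex.liftCycles_i
    K _ _ _ (toChain_cycle R S)) c)).trans ?_
  refine Eq.trans ?_ (ConcreteCategory.congr_hom (HomologicalComplex.liftCycles_i
    K' _ _ _ (toChain_cycle R S')) c').symm
  refine (f_toChain R f 1 c.1).trans ?_
  rw [h]
  rfl

end Chains

/-! ### Lifting singular simplices -/

theorem _root_.Convex.locallyPathConnectedSpace_coe {V : Type*} [SeminormedAddCommGroup V]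
    [NormedSpace ℝ V] {s : Set V} (hs : Convex ℝ s) : LocallyPathConnectedSpace s := by
  refine LocallyPathConnectedSpace.of_bases (fun x => Metric.nhds_basis_ball) fun x r hr => ?_
  rw [IsInducing.subtypeVal.isPathConnected_iff]
  have : Subtype.val '' Metric.ball x r = s ∩ Metric.ball (x : V) r := by
    ext y
    simp [and_comm]
  rw [this]
  exact (hs.inter (convex_ball _ _)).isPathConnected ⟨x, x.2, Metric.mem_ball_self hr⟩

/-- With contractibility, this is what the lifting criterion for covering maps asks of the source of
a singular simplex. -/
instance (n : ℕ) : LocallyPathConnectedSpace (stdSimplex ℝ (Fin n)) :=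
  (convex_stdSimplex ℝ (Fin n)).locallyPathConnectedSpace_coe

instance (n : ℕ) : ContractibleSpace (stdSimplex ℝ (Fin (n + 1))) :=
  (convex_stdSimplex ℝ (Fin (n + 1))).contractibleSpace ⟨_, (stdSimplex.vertex 0).2⟩

/-- The singular simplicial set. -/
abbrev Sing (X : Type u) [TopologicalSpace X] : SSet.{u} := TopCat.toSSet.obj (TopCat.of X)

variable {X Y Z : Type u} [TopologicalSpace X] [TopologicalSpace Y] [TopologicalSpace Z]

/-- The map on singular simplicial sets induced by a continuous map. -/
abbrev singMap (f : C(X, Y)) : Sing X ⟶ Sing Y := TopCat.toSSet.map (TopCat.ofHom f)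

/-- A singular simplex, as a continuous map. -/
def real {n : ℕ} (σ : (Sing X) _⦋n⦌) : C(stdSimplex ℝ (Fin (n + 1)), X) :=
  TopCat.toSSetObjEquiv (TopCat.of X) (.op ⦋n⦌) σ

/-- A continuous map on a simplex, as a singular simplex. -/
def ofReal {n : ℕ} (f : C(stdSimplex ℝ (Fin (n + 1)), X)) : (Sing X) _⦋n⦌ :=
  (TopCat.toSSetObjEquiv (TopCat.of X) (.op ⦋n⦌)).symm f

theorem real_ofReal {n : ℕ} (f : C(stdSimplex ℝ (Fin (n + 1)), X)) : real (ofReal f) = f :=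
  (TopCat.toSSetObjEquiv (TopCat.of X) (.op ⦋n⦌)).apply_symm_apply f

theorem real_injective {n : ℕ} : Function.Injective (real (X := X) (n := n)) :=
  (TopCat.toSSetObjEquiv (TopCat.of X) (.op ⦋n⦌)).injective

theorem real_singMap {n : ℕ} (f : C(X, Y)) (σ : (Sing X) _⦋n⦌) :
    real ((singMap f).app _ σ) = f.comp (real σ) := rfl

theorem real_δ {n : ℕ} (σ : (Sing X) _⦋n + 1⦌) (i : Fin (n + 2)) (s : stdSimplex ℝ (Fin (n + 1))) :
    real ((Sing X).δ i σ) s = real σ (stdSimplex.map i.succAbove s) := rfl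

theorem singMap_comp (g : C(Y, Z)) (f : C(X, Y)) :
    singMap (g.comp f) = singMap f ≫ singMap g := by
  rw [singMap, TopCat.ofHom_comp, CategoryTheory.Functor.map_comp]

section HomologyClass

variable (R : Type) [CommRing R]

theorem chainMap_singMap_comp (g : C(Y, Z)) (f : C(X, Y)) (n : ℕ) (c : (Sing X) _⦋n⦌ →₀ R) :
    chainMap R (singMap (g.comp f)) n c =
      chainMap R (singMap g) n (chainMap R (singMap f) n c) := by
  rw [singMap_comp]
  exact Finsupp.mapDomain_comp (v := c) (f := (singMap f).app (.op ⦋n⦌))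
    (g := (singMap g).app (.op ⦋n⦌))

/-- The class in `H_1(X; R)` of a singular `1`-cycle. -/
def homologyClass (X : Type u) [TopologicalSpace X] : cycles₁ R (Sing X) →ₗ[R] H1 R X :=
  cls R (Sing X)

theorem homologyClass_surjective : Function.Surjective (homologyClass R X) :=
  cls_surjective R (Sing X)

theorem homologyClass_eq_zero_iff (c : cycles₁ R (Sing X)) :
    homologyClass R X c = 0 ↔ ∃ d, bd R (Sing X) 1 d = c.1 :=
  cls_eq_zero_iff R (Sing X) c

/-- The map on `1`-cycles induced by a map of simplicial sets. -/
def cyclesMap₁ {S S' : SSet.{u}} (f : S ⟶ S') : cycles₁ R S →ₗ[R] cycles₁ R S' :=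
  (chainMap R f 1).restrict fun c hc => by
    rw [cycles₁, LinearMap.mem_ker] at hc ⊢
    rw [bd_chainMap R f 0, hc, map_zero]

theorem h1Map_homologyClass (f : C(X, Y)) (c : cycles₁ R (Sing X)) :
    h1Map R f (homologyClass R X c) = homologyClass R Y (cyclesMap₁ R (singMap f) c) :=
  homologyMap_cls R (singMap f) c _ rfl

theorem single_pathSimplex_mem {x : X} (γ : Path x x) (a : R) :
    Finsupp.single (pathSimplex γ) a ∈ cycles₁ R (Sing X) := by
  rw [cycles₁, LinearMap.mem_ker, bd_single, Fin.sum_univ_two, pathSimplex_boundary]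
  simp

theorem loopClass_eq {x : X} (γ : Path x x) :
    loopClass R γ = homologyClass R X ⟨_, single_pathSimplex_mem R γ 1⟩ := by
  let K := (Sing X).chainComplex (ModuleCat.of R (ULift.{u} R))
  refine congrArg (K.homologyπ 1).hom ?_
  apply iCycles_injective R (Sing X) 1
  refine (ConcreteCategory.congr_hom (HomologicalComplex.liftCycles_i
    K _ _ _ (pathSimplex_cycle R γ)) _).trans ?_
  refine Eq.trans ?_ (ConcreteCategory.congr_hom (HomologicalComplex.liftCycles_i
    K _ _ _ (toChain_cycle R (Sing X))) _).symm
  exact (toChain_single R (Sing X) 1 (pathSimplex γ) 1).symm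

end HomologyClass

/-! ### Chains on a set with a free action of `ℤ` -/

section FreeAction

variable {R S S' : Type*} [CommRing R]

/-- Choosing one representative in each fibre of `q`, every chain is congruent modulo `P` to its
push onto the representatives, and that push factors through `mapDomain q`. -/
theorem mem_of_mapDomain_eq_zero {q : S → S'} (P : Submodule R (S →₀ R))
    (hP : ∀ a b, q a = q b → ∀ r : R, Finsupp.single a r - Finsupp.single b r ∈ P)
    {c : S →₀ R} (hc : c.mapDomain q = 0) : c ∈ P := by
  rcases isEmpty_or_nonempty S with h | h
  · rw [Subsingleton.elim c 0]
    exact zero_mem P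
  have key : ∀ c : S →₀ R, c - c.mapDomain (Function.invFun q ∘ q) ∈ P := by
    intro c
    induction c using Finsupp.induction_linear with
    | zero => simp
    | add a b ha hb =>
      rw [Finsupp.mapDomain_add, add_sub_add_comm]
      exact add_mem ha hb
    | single a r =>
      rw [Finsupp.mapDomain_single]
      exact hP _ _ (Function.invFun_eq ⟨a, rfl⟩).symm r
  have := key c
  rwa [Finsupp.mapDomain_comp, hc, Finsupp.mapDomain_zero, sub_zero] at this

variable [AddAction ℤ S]

/-- An invariant chain has constant coefficients along orbits; a point with trivial stabilizer would
make its support infinite. -/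
theorem exists_vadd_eq_of_mapDomain_vadd_eq {c : S →₀ R}
    (hc : c.mapDomain ((1 : ℤ) +ᵥ ·) = c) {a : S} (ha : c a ≠ 0) :
    ∃ m : ℤ, m ≠ 0 ∧ m +ᵥ a = a := by
  by_contra! h
  have key : ∀ m : ℕ, c ((m : ℤ) +ᵥ a) = c a := by
    intro m
    induction m with
    | zero => simp
    | succ m ih =>
      rw [← ih]
      conv_lhs => rw [← hc]
      rw [Nat.cast_succ, add_comm, add_vadd]
      exact Finsupp.mapDomain_apply (AddAction.injective (1 : ℤ)) c _
  refine Set.infinite_of_injective_forall_mem (f := fun m : ℕ => (m : ℤ) +ᵥ a) ?_ ?_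
    c.support.finite_toSet
  · intro m n hmn
    by_contra hne
    refine h ((m : ℤ) - n) (by omega) ?_
    rw [sub_eq_neg_add, add_vadd, show (m : ℤ) +ᵥ a = (n : ℤ) +ᵥ a from hmn, ← add_vadd]
    simp
  · intro m
    simpa [key] using ha

theorem eq_zero_of_mapDomain_vadd_eq (hfree : ∀ (m : ℤ) (a : S), m +ᵥ a = a → m = 0)
    {c : S →₀ R} (hc : c.mapDomain ((1 : ℤ) +ᵥ ·) = c) : c = 0 := by
  by_contra h
  obtain ⟨a, ha⟩ := Finsupp.ne_iff.1 h
  obtain ⟨m, hm, hma⟩ := exists_vadd_eq_of_mapDomain_vadd_eq hc ha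
  exact hm (hfree m a hma)

/-- The kernel of `mapDomain q` is generated by differences within a fibre, and a difference between
`a` and `m +ᵥ a` telescopes into unit steps. -/
theorem exists_mapDomain_vadd_sub_eq {q : S → S'}
    (hfib : ∀ a b, q a = q b → ∃ m : ℤ, m +ᵥ a = b) {c : S →₀ R} (hc : c.mapDomain q = 0) :
    ∃ e : S →₀ R, e.mapDomain ((1 : ℤ) +ᵥ ·) - e = c := by
  let D : (S →₀ R) →ₗ[R] (S →₀ R) := Finsupp.lmapDomain R R ((1 : ℤ) +ᵥ ·) - LinearMap.id
  suffices c ∈ LinearMap.range D from this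
  have hstep : ∀ (m : ℤ) (a : S) (r : R),
      Finsupp.single (m +ᵥ a) r - Finsupp.single a r ∈ LinearMap.range D := by
    intro m a r
    have h1 : ∀ b : S, Finsupp.single ((1 : ℤ) +ᵥ b) r - Finsupp.single b r ∈ LinearMap.range D :=
      fun b => ⟨Finsupp.single b r, by simp [D]⟩
    induction m with
    | zero => simp
    | succ m ih =>
      have := add_mem (h1 ((m : ℤ) +ᵥ a)) ih
      rwa [sub_add_sub_cancel, ← add_vadd, add_comm] at this
    | pred m ih =>
      have := sub_mem ih (h1 ((-(m : ℤ) - 1) +ᵥ a))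
      rw [← add_vadd, add_sub_cancel] at this
      convert this using 1
      abel
  refine mem_of_mapDomain_eq_zero _ (fun a b hab r => ?_) hc
  obtain ⟨m, rfl⟩ := hfib b a hab.symm
  exact hstep m b r

end FreeAction

/-! ### Singular simplices of the finite cyclic covers -/

section Deck

variable {X E : Type u} [TopologicalSpace X] [TopologicalSpace E] [AddAction ℤ E] {p : E → X}

theorem isAddQuotientCoveringMap_proj (hp : IsAddQuotientCoveringMap p ℤ) (k : ℕ) :
    IsAddQuotientCoveringMap (proj k E) (AddSubgroup.zmultiples (k : ℤ)) where
  toIsQuotientMap := isQuotientMap_quotient_mk'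
  continuous_const_vadd g := hp.continuous_const_vadd g.1
  apply_eq_iff_mem_orbit := Quotient.eq
  disjoint e := by
    obtain ⟨U, hU, h⟩ := hp.disjoint e
    exact ⟨U, hU, fun g hg => Subtype.ext (h g.1 hg)⟩

theorem exists_singMap_proj_eq (hp : IsAddQuotientCoveringMap p ℤ) (k n : ℕ)
    (σ : (Sing (CyclicQuotient k E)) _⦋n⦌) :
    ∃ τ : (Sing E) _⦋n⦌, (singMap (proj k E)).app _ τ = σ := by
  have hq := isAddQuotientCoveringMap_proj hp k
  obtain ⟨e, he⟩ := hq.surjective (real σ (stdSimplex.vertex 0))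
  obtain ⟨F, ⟨-, hF⟩, -⟩ := hq.isCoveringMap.existsUnique_continuousMap_lifts (real σ) _ e he
  refine ⟨ofReal F, real_injective ?_⟩
  rw [real_singMap, real_ofReal]
  exact DFunLike.coe_injective hF

theorem chainMap_proj_surjective (R : Type) [CommRing R]
    (hp : IsAddQuotientCoveringMap p ℤ) (k n : ℕ) :
    Function.Surjective (chainMap R (singMap (proj k E)) n) :=
  Finsupp.mapDomain_surjective (exists_singMap_proj_eq hp k n)

variable [ContinuousConstVAdd ℤ E]

/-- A power of `T ^ k` matches the two lifts at a vertex, and lifts of a map from a connected space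
agreeing at a point coincide. -/
theorem exists_deck_eq_of_singMap_proj_eq (hp : IsAddQuotientCoveringMap p ℤ) (k n : ℕ)
    (σ τ : (Sing E) _⦋n⦌)
    (h : (singMap (proj k E)).app _ σ = (singMap (proj k E)).app _ τ) :
    ∃ m : ℤ, (singMap (deck E (m * k))).app _ σ = τ := by
  have hq := isAddQuotientCoveringMap_proj hp k
  have hr : (proj k E).comp (real σ) = (proj k E).comp (real τ) := by
    rw [← real_singMap, ← real_singMap, h]
  obtain ⟨⟨g, m, rfl⟩, hg⟩ := hq.apply_eq_iff_mem_orbit.1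
    (DFunLike.congr_fun hr (stdSimplex.vertex 0)).symm
  refine ⟨m, real_injective ?_⟩
  rw [real_singMap]
  refine DFunLike.coe_injective (hq.isCoveringMap.eq_of_comp_eq (ContinuousMap.continuous _)
    (ContinuousMap.continuous _) ?_ (stdSimplex.vertex 0) ?_)
  · ext s
    refine Eq.trans ?_ (DFunLike.congr_fun hr s)
    exact hq.map_vadd ⟨m * k, m, rfl⟩
  · simpa [deck] using hg

theorem eq_zero_of_singMap_deck_eq (hp : IsAddQuotientCoveringMap p ℤ) {n : ℕ} {m : ℤ}
    {σ : (Sing E) _⦋n⦌} (h : (singMap (deck E m)).app _ σ = σ) : m = 0 := by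
  have := hp.isCancelVAdd
  have h' : m +ᵥ real σ (stdSimplex.vertex 0) = real σ (stdSimplex.vertex 0) :=
    DFunLike.congr_fun (congrArg real h) (stdSimplex.vertex 0)
  exact IsCancelVAdd.right_cancel m 0 _ (h'.trans (zero_vadd ℤ _).symm)

/-- The action of `ℤ` on singular simplices through the powers of `T ^ k`. -/
@[reducible] def simplexAction (E : Type u) [TopologicalSpace E] [AddAction ℤ E]
    [ContinuousConstVAdd ℤ E] (k n : ℕ) : AddAction ℤ ((Sing E) _⦋n⦌) where
  vadd m σ := (singMap (deck E (m * k))).app _ σ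
  zero_vadd σ := real_injective <| by
    ext s
    change ((0 : ℤ) * k) +ᵥ real σ s = _
    rw [zero_mul, zero_vadd]
  add_vadd a b σ := real_injective <| by
    ext s
    change ((a + b) * k : ℤ) +ᵥ real σ s = (a * k : ℤ) +ᵥ (b * k : ℤ) +ᵥ real σ s
    rw [add_mul, add_vadd]

theorem simplexAction_one (k n : ℕ) :
    letI := simplexAction E k n
    (fun σ : (Sing E) _⦋n⦌ => (1 : ℤ) +ᵥ σ) = (singMap (deck E k)).app (.op ⦋n⦌) := by
  ext σ
  change (singMap (deck E (1 * k))).app _ σ = _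
  rw [one_mul]

variable (R : Type) [CommRing R]

theorem eq_zero_of_chainMap_deck_eq (hp : IsAddQuotientCoveringMap p ℤ) {k : ℕ} (hk : 0 < k)
    {n : ℕ} {c : (Sing E) _⦋n⦌ →₀ R} (hc : chainMap R (singMap (deck E k)) n c = c) : c = 0 := by
  let := simplexAction E k n
  refine eq_zero_of_mapDomain_vadd_eq (fun m σ h => ?_) ?_
  · have := eq_zero_of_singMap_deck_eq hp h
    exact (mul_eq_zero.1 this).resolve_right (by exact_mod_cast hk.ne')
  · rw [simplexAction_one]
    exact hc

theorem exists_chainMap_deck_sub_eq (hp : IsAddQuotientCoveringMap p ℤ) {k : ℕ}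
    {n : ℕ} {c : (Sing E) _⦋n⦌ →₀ R} (hc : chainMap R (singMap (proj k E)) n c = 0) :
    ∃ e, chainMap R (singMap (deck E k)) n e - e = c := by
  let := simplexAction E k n
  obtain ⟨e, he⟩ := exists_mapDomain_vadd_sub_eq
    (exists_deck_eq_of_singMap_proj_eq hp k n) hc
  rw [simplexAction_one] at he
  exact ⟨e, he⟩

theorem proj_comp_deck (k : ℕ) : (proj k E).comp (deck E k) = proj k E := by
  ext e
  exact Quotient.sound ⟨⟨k, 1, by simp⟩, rfl⟩

theorem chainMap_proj_deck (k n : ℕ) (c : (Sing E) _⦋n⦌ →₀ R) :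
    chainMap R (singMap (proj k E)) n (chainMap R (singMap (deck E k)) n c) =
      chainMap R (singMap (proj k E)) n c := by
  rw [← chainMap_singMap_comp, proj_comp_deck]

theorem h1Map_proj_deck (k : ℕ) (v : H1 R E) :
    h1Map R (proj k E) (h1Map R (deck E k) v) = h1Map R (proj k E) v := by
  rw [← LinearMap.comp_apply, ← h1Map_comp, proj_comp_deck]

/-- Exactness at the left end of the Milnor sequence of the covering `E → E / T ^ k`. -/
theorem h1Map_proj_eq_zero_iff (hp : IsAddQuotientCoveringMap p ℤ) {k : ℕ} (hk : 0 < k)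
    (v : H1 R E) : h1Map R (proj k E) v = 0 ↔ ∃ w, h1Map R (deck E k) w - w = v := by
  constructor
  · intro hv
    obtain ⟨c, rfl⟩ := homologyClass_surjective R v
    rw [h1Map_homologyClass, homologyClass_eq_zero_iff] at hv
    obtain ⟨d', hd'⟩ := hv
    obtain ⟨d, rfl⟩ := chainMap_proj_surjective R hp k 2 d'
    -- Correcting `c` by the boundary of a lifted bounding chain puts it in the kernel of `q`, hence
    -- in the image of `T ^ k - 1`.
    have h0 : chainMap R (singMap (proj k E)) 1 (c.1 - bd R (Sing E) 1 d) = 0 := by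
      rw [map_sub, ← bd_chainMap R _ 1, sub_eq_zero]
      exact hd'.symm
    obtain ⟨e, he⟩ := exists_chainMap_deck_sub_eq R hp h0
    -- `T ^ k - 1` kills the boundary of `e`, and it is injective on chains because the action is
    -- free.
    have he0 : e ∈ cycles₁ R (Sing E) := by
      refine eq_zero_of_chainMap_deck_eq R hp hk ?_
      rw [← sub_eq_zero, ← bd_chainMap R _ 0, ← map_sub, he, map_sub,
        bd_bd R _ 0, sub_zero]
      exact c.2
    refine ⟨homologyClass R E ⟨e, he0⟩, ?_⟩
    rw [h1Map_homologyClass, ← map_sub, ← sub_eq_zero, ← map_sub, homologyClass_eq_zero_iff]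
    refine ⟨-d, ?_⟩
    rw [map_neg]
    change -bd R (Sing E) 1 d = chainMap R (singMap (deck E k)) 1 e - e - c.1
    rw [he]
    abel
  · rintro ⟨w, rfl⟩
    rw [map_sub, h1Map_proj_deck, sub_self]

end Deck

/-! ### Path components and chains -/

section Components

variable {X Y : Type u} [TopologicalSpace X] [TopologicalSpace Y]

theorem zerothHomotopy_mk_eq_iff {x y : X} :
    ZerothHomotopy.mk x = ZerothHomotopy.mk y ↔ Joined x y :=
  Quotient.eq (r := pathSetoid X)

/-- The map on path components induced by a continuous map. -/
def componentMap (f : C(X, Y)) : ZerothHomotopy X → ZerothHomotopy Y :=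
  ZerothHomotopy.lift (fun x => ZerothHomotopy.mk (f x))
    fun _ _ γ => ZerothHomotopy.sound (γ.map f.continuous)

/-- The path component containing a singular simplex. -/
def component {n : ℕ} (σ : (Sing X) _⦋n⦌) : ZerothHomotopy X :=
  ZerothHomotopy.mk (real σ (stdSimplex.vertex 0))

theorem mk_real_eq_component {n : ℕ} (σ : (Sing X) _⦋n⦌) (s : stdSimplex ℝ (Fin (n + 1))) :
    ZerothHomotopy.mk (real σ s) = component σ :=
  zerothHomotopy_mk_eq_iff.2 ((PathConnectedSpace.joined s _).map (real σ).continuous)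

theorem component_δ {n : ℕ} (σ : (Sing X) _⦋n + 1⦌) (i : Fin (n + 2)) :
    component ((Sing X).δ i σ) = component σ :=
  mk_real_eq_component σ _

theorem component_pathSimplex {x y : X} (γ : Path x y) :
    component (pathSimplex γ) = ZerothHomotopy.mk x := by
  have : pathOnSimplex γ (stdSimplex.vertex 0) = x := by
    simp [pathOnSimplex, stdSimplex.vertex]
  exact congrArg ZerothHomotopy.mk this

theorem δ_zero_pathSimplex {x y : X} (γ : Path x y) :
    (Sing X).δ 0 (pathSimplex γ) = ofReal (ContinuousMap.const _ y) := by
  apply real_injective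
  ext s
  have hs : s = stdSimplex.vertex (0 : Fin 1) := Subsingleton.elim _ _
  rw [real_δ, hs, stdSimplex.map_vertex, real_ofReal]
  change pathOnSimplex γ (stdSimplex.vertex 1) = y
  simp [pathOnSimplex, stdSimplex.vertex]

theorem δ_one_pathSimplex {x y : X} (γ : Path x y) :
    (Sing X).δ 1 (pathSimplex γ) = ofReal (ContinuousMap.const _ x) := by
  apply real_injective
  ext s
  have hs : s = stdSimplex.vertex (0 : Fin 1) := Subsingleton.elim _ _
  rw [real_δ, hs, stdSimplex.map_vertex, real_ofReal]
  change pathOnSimplex γ (stdSimplex.vertex 0) = x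
  simp [pathOnSimplex, stdSimplex.vertex]

theorem ofReal_const_real (σ : (Sing X) _⦋0⦌) :
    ofReal (ContinuousMap.const _ (real σ (stdSimplex.vertex 0))) = σ := by
  apply real_injective
  ext s
  rw [real_ofReal, Subsingleton.elim s (stdSimplex.vertex 0)]
  rfl

variable (R : Type) [CommRing R]

theorem mapDomain_component_bd (c : (Sing X) _⦋1⦌ →₀ R) :
    (bd R (Sing X) 0 c).mapDomain component = 0 := by
  induction c using Finsupp.induction_linear with
  | zero => simp
  | add a b ha hb => rw [map_add, Finsupp.mapDomain_add, ha, hb, add_zero]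
  | single σ a =>
    rw [bd_single, Fin.sum_univ_two, Finsupp.mapDomain_add, Finsupp.mapDomain_single,
      Finsupp.mapDomain_single, component_δ, component_δ, ← Finsupp.single_add]
    simp

/-- Two points of one component differ by the boundary of a path; this is the description of `H_0`
by path components. -/
theorem exists_bd_eq_of_mapDomain_component_eq_zero {c : (Sing X) _⦋0⦌ →₀ R}
    (hc : c.mapDomain component = 0) : ∃ w, bd R (Sing X) 0 w = c := by
  refine mem_of_mapDomain_eq_zero (LinearMap.range (bd R (Sing X) 0)) (fun σ τ h r => ?_) hc
  obtain ⟨γ⟩ := zerothHomotopy_mk_eq_iff.1 h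
  -- The sign is negative because the boundary of a path is its end minus its start, and `γ` starts
  -- at `σ`.
  refine ⟨Finsupp.single (pathSimplex γ) (-r), ?_⟩
  rw [bd_single, Fin.sum_univ_two, δ_zero_pathSimplex, δ_one_pathSimplex, ofReal_const_real,
    ofReal_const_real, sub_eq_neg_add]
  simp

open Classical in
/-- The part of a chain lying in a path component. -/
def componentPart (b : ZerothHomotopy X) (n : ℕ) : ((Sing X) _⦋n⦌ →₀ R) →+ ((Sing X) _⦋n⦌ →₀ R) :=
  Finsupp.filterAddHom fun σ => component σ = b

open Classical in
theorem componentPart_single (b : ZerothHomotopy X) (n : ℕ) (σ : (Sing X) _⦋n⦌) (r : R) :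
    componentPart R b n (Finsupp.single σ r) =
      if component σ = b then Finsupp.single σ r else 0 := by
  split_ifs with h
  · exact Finsupp.filter_single_of_pos (fun σ => component σ = b) h
  · exact Finsupp.filter_single_of_neg (fun σ => component σ = b) h

theorem bd_componentPart (b : ZerothHomotopy X) (n : ℕ) (c : (Sing X) _⦋n + 1⦌ →₀ R) :
    bd R (Sing X) n (componentPart R b (n + 1) c) = componentPart R b n (bd R (Sing X) n c) := by
  classical
  induction c using Finsupp.induction_linear with
  | zero => simp
  | add x y hx hy => simp only [map_add, hx, hy]
  | single σ a =>
    rw [bd_single, map_sum, componentPart_single]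
    simp only [componentPart_single, component_δ]
    split_ifs
    · rw [bd_single]
    · simp

/-- Restricting a bounding chain to one path component isolates a single term of a relation; `ρ`
then forces its coefficient to vanish. -/
theorem linearIndependent_loopClass {ι : Type*} {x : ι → X} (γ : ∀ i, Path (x i) (x i))
    (hx : Function.Injective fun i => ZerothHomotopy.mk (x i)) (ρ : H1 ℤ X →+ ℤ)
    (hρ : ∀ i, ρ (loopClass ℤ (γ i)) ≠ 0) :
    LinearIndependent ℤ fun i => loopClass ℤ (γ i) := by
  classical
  rw [linearIndependent_iff]
  intro l hl
  let z : ι → cycles₁ ℤ (Sing X) := fun i => ⟨_, single_pathSimplex_mem ℤ (γ i) 1⟩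
  have hz : homologyClass ℤ X (l.sum fun i a => a • z i) = 0 := by
    rw [← hl, Finsupp.linearCombination_apply, Finsupp.sum, Finsupp.sum, map_sum]
    refine Finset.sum_congr rfl fun i _ => ?_
    rw [map_zsmul, ← loopClass_eq]
  obtain ⟨d, hd⟩ := (homologyClass_eq_zero_iff ℤ _).1 hz
  ext i
  have hi : bd ℤ (Sing X) 1 (componentPart ℤ (ZerothHomotopy.mk (x i)) 2 d) = (l i • z i).1 := by
    rw [bd_componentPart ℤ _ 1, hd]
    have : (l.sum fun i a => a • z i).1 =
        l.sum fun i a => a • Finsupp.single (pathSimplex (γ i)) 1 :=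
      map_finsuppSum (cycles₁ ℤ (Sing X)).subtype _ _
    rw [this, Finsupp.sum, map_sum, Finset.sum_eq_single i]
    · rw [map_zsmul, componentPart_single, if_pos (component_pathSimplex _)]
      rfl
    · intro j _ hj
      rw [map_zsmul, componentPart_single, if_neg, smul_zero]
      rw [component_pathSimplex]
      exact fun h => hj (hx h)
    · intro h
      rw [Finsupp.notMem_support_iff.1 h, zero_smul, map_zero]
  have h0 := (homologyClass_eq_zero_iff ℤ (l i • z i)).2 ⟨_, hi⟩
  rw [map_zsmul, ← loopClass_eq] at h0
  have h1 := congrArg ρ h0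
  rw [map_zero] at h1
  have h2 : l i * ρ (loopClass ℤ (γ i)) = 0 := by
    rw [← h1, ← smul_eq_mul]
    exact (map_zsmul ρ _ _).symm
  exact (mul_eq_zero.1 h2).resolve_right (hρ i)

end Components

/-! ### The cokernel of `H_1(E) → H_1(E / T ^ k)` -/

section Cokernel

variable {X E : Type u} [TopologicalSpace X] [TopologicalSpace E] [AddAction ℤ E]

/-- The path components of `E` fixed by a nontrivial deck transformation. -/
def periodicComponents (E : Type u) [TopologicalSpace E] [AddAction ℤ E] :
    Set (ZerothHomotopy E) :=
  {a | ∃ (e : E) (n : ℤ), n ≠ 0 ∧ Joined e (n +ᵥ e) ∧ ZerothHomotopy.mk e = a}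

theorem exists_h1Map_descend_eq_pow (R : Type) [CommRing R] {k : ℕ} (f : C(E, E))
    (hf : ∀ (n : ℤ) (e : E), f (n +ᵥ e) = n +ᵥ f e) (N : ℕ) :
    ∃ (g : C(E, E)) (hg : ∀ (n : ℤ) (e : E), g (n +ᵥ e) = n +ᵥ g e), ⇑g = f^[N] ∧
      h1Map R (descend k g hg) = h1Map R (descend k f hf) ^ N := by
  induction N with
  | zero =>
    refine ⟨ContinuousMap.id E, fun _ _ => rfl, rfl, ?_⟩
    rw [pow_zero, Module.End.one_eq_id, ← h1Map_id]
    congr 1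
    ext e
    induction e using Quotient.inductionOn
    rfl
  | succ N ih =>
    obtain ⟨g, hg, hgf, h⟩ := ih
    refine ⟨f.comp g, fun n e => ?_, ?_, ?_⟩
    · simp only [ContinuousMap.comp_apply, hg, hf]
    · rw [ContinuousMap.coe_comp, hgf, Function.iterate_succ']
    · rw [pow_succ', ← h, Module.End.mul_eq_comp, ← h1Map_comp]
      congr 1
      ext e
      induction e using Quotient.inductionOn
      rfl

variable [ContinuousConstVAdd ℤ E] {p : E → X}

theorem joined_vadd {e e' : E} (n : ℤ) (h : Joined e e') : Joined (n +ᵥ e) (n +ᵥ e') :=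
  h.map (continuous_const_vadd n)

theorem joined_mul_vadd {e : E} {n : ℤ} (h : Joined e (n +ᵥ e)) (m : ℤ) :
    Joined e ((m * n) +ᵥ e) := by
  induction m with
  | zero => simpa using Joined.refl e
  | succ m ih =>
    refine h.trans ?_
    rw [add_mul, one_mul, add_comm, add_vadd]
    exact joined_vadd n ih
  | pred m ih =>
    refine ih.trans ?_
    have := (joined_vadd (-(m : ℤ) * n - n) h).symm
    rw [← add_vadd, sub_add_cancel] at this
    rwa [sub_mul, one_mul]

/-- Finiteness is checked on the image in the components of `X`, by independence of loop classes,
and on each fibre, by reducing deck translations modulo a period. -/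
theorem finite_periodicComponents {ρ : H1 ℤ X →+ ℤ} [Module.Finite ℤ (H1 ℤ X)]
    (hp : IsCoverAssociatedTo p ρ) : (periodicComponents E).Finite := by
  have hcov := hp.toIsAddQuotientCoveringMap.isCoveringMap
  let P : C(E, X) := ⟨p, hcov.continuous⟩
  refine Set.Finite.of_finite_fibers (componentMap P) ?_ ?_
  · have key : ∀ b : componentMap P '' periodicComponents E, ∃ (x : X) (γ : Path x x),
        ZerothHomotopy.mk x = b.1 ∧ ρ (loopClass ℤ γ) ≠ 0 := by
      -- A path from `e` to `n +ᵥ e` projects to a loop whose monodromy is `n ≠ 0`.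
      rintro ⟨_, _, ⟨e, n, hn, ⟨δ⟩, rfl⟩, rfl⟩
      have hpe : p (n +ᵥ e) = p e := hp.toIsAddQuotientCoveringMap.map_vadd n
      refine ⟨p e, (δ.map hcov.continuous).cast rfl hpe.symm, rfl, ?_⟩
      rw [hp.monodromy e _ n δ fun t => rfl]
      exact hn
    choose x γ hx hγ using key
    have hli := linearIndependent_loopClass γ (fun b b' h => Subtype.ext <| by
      rw [← hx b, ← hx b']; exact h) ρ hγ
    have := hli.finite_of_isNoetherian
    exact Set.toFinite _
  · rintro b -
    rcases (periodicComponents E ∩ componentMap P ⁻¹' {b}).eq_empty_or_nonempty with h | h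
    · rw [h]
      exact Set.finite_empty
    · obtain ⟨_, ⟨e, n, hn, hne, rfl⟩, hb⟩ := h
      -- Path lifting joins any point over this component to some `m +ᵥ e`, and the period `n` of
      -- `e` lets `m` be replaced by `m % n`.
      refine ((Set.finite_Ico (0 : ℤ) |n|).image fun m => ZerothHomotopy.mk (m +ᵥ e)).subset ?_
      rintro a ⟨-, ha⟩
      induction a with | mk e' =>
      have hj : Joined (p e') (p e) := zerothHomotopy_mk_eq_iff.1 (ha.trans hb.symm)
      obtain ⟨γ⟩ := hj
      obtain ⟨Γ, hΓ, hΓ0⟩ := hcov.exists_path_lifts γ e' γ.source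
      have h1 : p (Γ 1) = p e := (congrFun hΓ 1).trans γ.target
      obtain ⟨m, hm⟩ := hp.toIsAddQuotientCoveringMap.apply_eq_iff_mem_orbit.1 h1
      refine ⟨m % n, ⟨Int.emod_nonneg _ hn, Int.emod_lt_abs _ hn⟩, ?_⟩
      refine zerothHomotopy_mk_eq_iff.2 (Joined.trans ?_ (Joined.symm ⟨⟨Γ, hΓ0, rfl⟩⟩))
      have hm' : Γ.toFun 1 = m +ᵥ e := hm.symm
      rw [hm']
      have := joined_vadd (m % n) (joined_mul_vadd hne (m / n))
      rwa [← add_vadd, mul_comm, Int.emod_add_mul_ediv] at this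

/-- A homeomorphism commuting with the deck group permutes the finite set of periodic components;
`N` is the exponent of a trivial power of this permutation. -/
theorem exists_iterate_joined {ρ : H1 ℤ X →+ ℤ} [Module.Finite ℤ (H1 ℤ X)]
    (hp : IsCoverAssociatedTo p ρ) (f : E ≃ₜ E) (hf : ∀ (n : ℤ) (e : E), f (n +ᵥ e) = n +ᵥ f e) :
    ∃ N : ℕ, 0 < N ∧ ∀ (e : E) (n : ℤ), n ≠ 0 → Joined e (n +ᵥ e) → Joined (f^[N] e) e := by
  have := (finite_periodicComponents hp).to_subtype
  have hmaps : Set.MapsTo (componentMap (f : C(E, E))) (periodicComponents E)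
      (periodicComponents E) := by
    rintro _ ⟨e, n, hn, h, rfl⟩
    refine ⟨f e, n, hn, ?_, rfl⟩
    rw [← hf]
    exact h.map f.continuous
  have hinj : Function.Injective (componentMap (f : C(E, E))) := by
    intro a b h
    induction a with | mk a =>
    induction b with | mk b =>
    have := (zerothHomotopy_mk_eq_iff.1 h).map f.symm.continuous
    simp only [ContinuousMap.coe_coe, Homeomorph.symm_apply_apply] at this
    exact zerothHomotopy_mk_eq_iff.2 this
  let σ : Equiv.Perm (periodicComponents E) := Equiv.ofBijective hmaps.restrict
    (Finite.injective_iff_bijective.1 (hmaps.restrict_inj.2 hinj.injOn))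
  obtain ⟨N, hN, hσ⟩ := (isOfFinOrder_of_finite σ).exists_pow_eq_one
  refine ⟨N, hN, fun e n hn h => zerothHomotopy_mk_eq_iff.1 ?_⟩
  have key : ∀ m : ℕ, ((σ ^ m) ⟨_, e, n, hn, h, rfl⟩).1 = ZerothHomotopy.mk (f^[m] e) := by
    intro m
    induction m with
    | zero => rfl
    | succ m ih =>
      rw [pow_succ', Function.iterate_succ_apply']
      exact congrArg (componentMap (f : C(E, E))) ih
  rw [← key, hσ]
  rfl

variable (R : Type) [CommRing R]

/-- The class of `d` in `H_0(E)` is `T ^ k`-invariant, so it is supported on periodic components,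
which `g` fixes. -/
theorem exists_bd_eq_chainMap_sub (k : ℕ) (hk : 0 < k) (g : C(E, E))
    (hfix : ∀ (e : E) (n : ℤ), n ≠ 0 → Joined e (n +ᵥ e) → Joined (g e) e)
    (d : (Sing E) _⦋0⦌ →₀ R) (c : (Sing E) _⦋1⦌ →₀ R)
    (hd : bd R (Sing E) 0 c = chainMap R (singMap (deck E k)) 0 d - d) :
    ∃ w, bd R (Sing E) 0 w = chainMap R (singMap g) 0 d - d := by
  apply exists_bd_eq_of_mapDomain_component_eq_zero
  have hcomp : ∀ f : C(E, E), (chainMap R (singMap f) 0 d).mapDomain component =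
      (d.mapDomain component).mapDomain (componentMap f) := fun f => by
    rw [← Finsupp.mapDomain_comp]
    exact (Finsupp.mapDomain_comp (v := d)).symm
  have hsub : ∀ x y : (Sing E) _⦋0⦌ →₀ R, (x - y).mapDomain component =
      x.mapDomain component - y.mapDomain component :=
    map_sub (Finsupp.lmapDomain R R (component (X := E) (n := 0)))
  -- Powers of `T ^ k` act on components; unlike the action on simplices, this one need not be free.
  let act : AddAction ℤ (ZerothHomotopy E) :=
    { vadd := fun m => componentMap (deck E (m * k))
      zero_vadd := fun a => by
        induction a with | mk e =>
        change ZerothHomotopy.mk ((0 * k : ℤ) +ᵥ e) = _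
        rw [zero_mul, zero_vadd]
      add_vadd := fun m n a => by
        induction a with | mk e =>
        change ZerothHomotopy.mk (((m + n) * k : ℤ) +ᵥ e) =
          ZerothHomotopy.mk ((m * k : ℤ) +ᵥ (n * k : ℤ) +ᵥ e)
        rw [add_mul, add_vadd] }
  have h1 : (fun a : ZerothHomotopy E => (1 : ℤ) +ᵥ a) = componentMap (deck E k) := by
    ext a
    change componentMap (deck E (1 * k)) a = _
    rw [one_mul]
  have hinv : (d.mapDomain component).mapDomain (fun a : ZerothHomotopy E => (1 : ℤ) +ᵥ a) =
      d.mapDomain component := by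
    have := mapDomain_component_bd R c
    rwa [hd, hsub, hcomp, ← h1, sub_eq_zero] at this
  rw [hsub, hcomp, sub_eq_zero]
  refine (Finsupp.mapDomain_congr fun a ha => ?_).trans Finsupp.mapDomain_id
  obtain ⟨m, hm, hma⟩ := exists_vadd_eq_of_mapDomain_vadd_eq hinv (Finsupp.mem_support_iff.1 ha)
  induction a with | mk e =>
  refine zerothHomotopy_mk_eq_iff.2 (hfix e (m * k) ?_ ?_)
  · exact mul_ne_zero hm (by exact_mod_cast hk.ne')
  · exact (zerothHomotopy_mk_eq_iff.1 hma).symm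

theorem h1Map_descend_sub_mem_range (hp : IsAddQuotientCoveringMap p ℤ) {k : ℕ} (hk : 0 < k)
    (g : C(E, E)) (hg : ∀ (n : ℤ) (e : E), g (n +ᵥ e) = n +ᵥ g e)
    (hfix : ∀ (e : E) (n : ℤ), n ≠ 0 → Joined e (n +ᵥ e) → Joined (g e) e)
    (z : H1 R (CyclicQuotient k E)) :
    h1Map R (descend k g hg) z - z ∈ LinearMap.range (h1Map R (proj k E)) := by
  obtain ⟨c', rfl⟩ := homologyClass_surjective R z
  obtain ⟨c, hc⟩ := chainMap_proj_surjective R hp k 1 c'.1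
  have hbd : chainMap R (singMap (proj k E)) 0 (bd R (Sing E) 0 c) = 0 := by
    rw [← bd_chainMap R _ 0, hc]
    exact c'.2
  obtain ⟨d, hd⟩ := exists_chainMap_deck_sub_eq R hp hbd
  obtain ⟨w, hw⟩ := exists_bd_eq_chainMap_sub R k hk g hfix d c hd.symm
  have hcomm : g.comp (deck E k) = (deck E k).comp g := by
    ext e
    exact hg k e
  -- The boundary of `g c - c` is `(T ^ k - 1)(g d - d)`, which is that of `(T ^ k - 1) w`.
  -- Subtracting the latter gives a cycle, and `q` kills the correction.
  let y : (Sing E) _⦋1⦌ →₀ R := chainMap R (singMap g) 1 c - c -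
    (chainMap R (singMap (deck E k)) 1 w - w)
  have hy : y ∈ cycles₁ R (Sing E) := by
    rw [cycles₁, LinearMap.mem_ker]
    simp only [y, map_sub]
    rw [bd_chainMap R _ 0, bd_chainMap R _ 0, hw, ← hd, map_sub, map_sub,
      ← chainMap_singMap_comp, hcomm, chainMap_singMap_comp]
    abel
  refine ⟨homologyClass R E ⟨y, hy⟩, ?_⟩
  rw [h1Map_homologyClass, h1Map_homologyClass, ← map_sub]
  refine congrArg _ (Subtype.ext ?_)
  change chainMap R (singMap (proj k E)) 1 y = chainMap R (singMap (descend k g hg)) 1 c'.1 - c'.1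
  have hq : chainMap R (singMap (proj k E)) 1 (chainMap R (singMap g) 1 c) =
      chainMap R (singMap (descend k g hg)) 1 (chainMap R (singMap (proj k E)) 1 c) :=
    (chainMap_singMap_comp R _ _ 1 c).symm.trans
      (chainMap_singMap_comp R (descend k g hg) (proj k E) 1 c)
  simp only [y, map_sub]
  rw [chainMap_proj_deck, hq, hc]
  abel

theorem exists_pow_h1Map_descend_sub_mem_range {ρ : H1 ℤ X →+ ℤ} [Module.Finite ℤ (H1 ℤ X)]
    (hp : IsCoverAssociatedTo p ρ) (f : E ≃ₜ E)
    (hf : ∀ (n : ℤ) (e : E), (f : C(E, E)) (n +ᵥ e) = n +ᵥ (f : C(E, E)) e) {k : ℕ} (hk : 0 < k) :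
    ∃ N : ℕ, 0 < N ∧ ∀ z : H1 R (CyclicQuotient k E),
      (h1Map R (descend k (f : C(E, E)) hf) ^ N) z - z ∈ LinearMap.range (h1Map R (proj k E)) := by
  obtain ⟨N, hN, hfix⟩ := exists_iterate_joined hp f hf
  obtain ⟨g, hg, hgf, h⟩ := exists_h1Map_descend_eq_pow R (k := k) (f : C(E, E)) hf N
  refine ⟨N, hN, fun z => ?_⟩
  rw [← h]
  refine h1Map_descend_sub_mem_range R hp.toIsAddQuotientCoveringMap hk g hg (fun e n hn he => ?_) z
  rw [hgf]
  exact hfix e n hn he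

end Cokernel

/-! ### Extension of scalars from `ℤ` to a field -/

section Scalars

/-- The additive subgroup generated by finitely many elements of `K` is finitely generated and
torsion-free, hence free. This reduces statements over `K` to integral chains, one coordinate at a
time. -/
theorem exists_integral_coordinates {K : Type*} [Field K] [CharZero K] (F : Finset K) :
    ∃ (m : ℕ) (w : Fin m → K) (κ : K → Fin m → ℤ), LinearIndependent ℤ w ∧ κ 0 = 0 ∧
      ∀ x ∈ F, x = ∑ j, w j * κ x j := by
  classical
  let G : Submodule ℤ K := Submodule.span ℤ (F : Set K)
  have : Module.Finite ℤ G := Module.Finite.span_of_finite ℤ F.finite_toSet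
  let b := Module.finBasis ℤ G
  refine ⟨_, fun j => (b j : K), fun x => if h : x ∈ G then b.repr ⟨x, h⟩ else 0, ?_, ?_, ?_⟩
  · exact b.linearIndependent.map' G.subtype (Submodule.ker_subtype G)
  · ext j
    have : (⟨0, G.zero_mem⟩ : G) = 0 := rfl
    simp [this]
  · intro x hx
    have hxG : x ∈ G := Submodule.subset_span hx
    have := congrArg Subtype.val (b.sum_repr ⟨x, hxG⟩)
    simp only [dif_pos hxG]
    refine this.symm.trans ?_
    rw [AddSubmonoidClass.coe_finsetSum]
    refine Finset.sum_congr rfl fun j _ => ?_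
    rw [Submodule.coe_smul, zsmul_eq_mul, mul_comm]

variable (K : Type) [Field K]

/-- Extension of scalars on chains. -/
def castChain (S : Type*) : (S →₀ ℤ) →+ (S →₀ K) :=
  Finsupp.mapRange.addMonoidHom (Int.castAddHom K)

theorem castChain_apply {S : Type*} (c : S →₀ ℤ) (σ : S) : castChain K S c σ = (c σ : K) := rfl

theorem castChain_single {S : Type*} (σ : S) (a : ℤ) :
    castChain K S (Finsupp.single σ a) = Finsupp.single σ (a : K) := by
  simp [castChain]

theorem bd_castChain (S : SSet.{u}) (n : ℕ) (c : S _⦋n + 1⦌ →₀ ℤ) :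
    bd K S n (castChain K _ c) = castChain K _ (bd ℤ S n c) := by
  induction c using Finsupp.induction_linear with
  | zero => simp
  | add a b ha hb => simp only [map_add, ha, hb]
  | single x a =>
    rw [castChain_single, bd_single, bd_single, map_sum]
    refine Finset.sum_congr rfl fun i _ => ?_
    rw [castChain_single]
    push_cast
    rfl

theorem chainMap_castChain {S S' : SSet.{u}} (f : S ⟶ S') (n : ℕ) (c : S _⦋n⦌ →₀ ℤ) :
    chainMap K f n (castChain K _ c) = castChain K _ (chainMap ℤ f n c) := by
  induction c using Finsupp.induction_linear with
  | zero => simp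
  | add a b ha hb => simp only [map_add, ha, hb]
  | single x a => rw [castChain_single, chainMap_single, chainMap_single, castChain_single]

theorem eq_of_sum_smul_castChain_eq {S : Type*} {m : ℕ} {w : Fin m → K}
    (hw : LinearIndependent ℤ w) {c c' : Fin m → S →₀ ℤ}
    (h : ∑ j, w j • castChain K S (c j) = ∑ j, w j • castChain K S (c' j)) : c = c' := by
  funext j
  ext σ
  have h' := DFunLike.congr_fun h σ
  simp only [Finsupp.finsetSum_apply, Finsupp.smul_apply, castChain_apply, smul_eq_mul] at h'
  rw [← sub_eq_zero, ← Finset.sum_sub_distrib] at h'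
  have := Fintype.linearIndependent_iff.1 hw (fun j => c j σ - c' j σ) (by
    rw [← h']
    refine Finset.sum_congr rfl fun j _ => ?_
    rw [zsmul_eq_mul, Int.cast_sub]
    ring) j
  exact sub_eq_zero.1 this

theorem eq_sum_smul_castChain {S : Type*} {m : ℕ} {w : Fin m → K} {κ : K → Fin m → ℤ}
    (hκ0 : κ 0 = 0) (c : S →₀ K) (hκ : ∀ σ ∈ c.support, c σ = ∑ j, w j * κ (c σ) j) :
    c = ∑ j, w j • castChain K S (c.mapRange (fun x => κ x j) (congrFun hκ0 j)) := by
  ext σ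
  simp only [Finsupp.finsetSum_apply, Finsupp.smul_apply, castChain_apply, smul_eq_mul,
    Finsupp.mapRange_apply]
  by_cases h : c σ = 0
  · simp [h, hκ0]
  · exact hκ σ (Finsupp.mem_support_iff.2 h)

variable {X Y : Type u} [TopologicalSpace X] [TopologicalSpace Y]

/-- Extension of scalars on `1`-cycles. -/
def castCycle (S : SSet.{u}) : cycles₁ ℤ S →+ cycles₁ K S :=
  ((castChain K _).comp (cycles₁ ℤ S).subtype.toAddMonoidHom).codRestrict
    (cycles₁ K S) fun c => by
      change bd K S 0 (castChain K _ c.1) = 0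
      have h : bd ℤ S 0 c.1 = 0 := c.2
      rw [bd_castChain K S 0, h, map_zero]

/-- Extension of scalars on the first singular homology. -/
def castH1 (X : Type u) [TopologicalSpace X] : H1 ℤ X →+ H1 K X :=
  (homologyClass ℤ X).toAddMonoidHom.liftOfSurjective (homologyClass_surjective ℤ)
    ⟨(homologyClass K X).toAddMonoidHom.comp (castCycle K (Sing X)), fun c hc => by
      obtain ⟨d, hd⟩ := (homologyClass_eq_zero_iff ℤ c).1 hc
      refine (homologyClass_eq_zero_iff K _).2 ⟨castChain K _ d, ?_⟩
      rw [bd_castChain K _ 1, hd]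
      rfl⟩

theorem castH1_homologyClass (c : cycles₁ ℤ (Sing X)) :
    castH1 K X (homologyClass ℤ X c) = homologyClass K X (castCycle K (Sing X) c) :=
  AddMonoidHom.liftOfRightInverse_comp_apply _ _ _ _ c

theorem h1Map_castH1 (f : C(X, Y)) (v : H1 ℤ X) :
    h1Map K f (castH1 K X v) = castH1 K Y (h1Map ℤ f v) := by
  obtain ⟨c, rfl⟩ := homologyClass_surjective ℤ v
  rw [castH1_homologyClass, h1Map_homologyClass, h1Map_homologyClass, castH1_homologyClass]
  exact congrArg _ (Subtype.ext (chainMap_castChain K (singMap f) 1 c.1))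

variable [CharZero K]

theorem span_range_castH1 : Submodule.span K (Set.range (castH1 K X)) = ⊤ := by
  classical
  rw [eq_top_iff]
  rintro v -
  obtain ⟨c, rfl⟩ := homologyClass_surjective K v
  obtain ⟨m, w, κ, hw, hκ0, hκ⟩ := exists_integral_coordinates (c.1.support.image c.1)
  have hc := eq_sum_smul_castChain K hκ0 c.1 fun σ h =>
    hκ _ (Finset.mem_image_of_mem c.1 h)
  set C : Fin m → (Sing X) _⦋1⦌ →₀ ℤ := fun j => c.1.mapRange (fun x => κ x j) (congrFun hκ0 j)
  -- Independence of `w` over `ℤ` makes each integral coordinate of a cycle a cycle.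
  have hC : (fun j => bd ℤ (Sing X) 0 (C j)) = 0 := by
    apply eq_of_sum_smul_castChain_eq K hw
    have h : bd K (Sing X) 0 c.1 = 0 := c.2
    rw [hc, map_sum] at h
    simp only [map_smul] at h
    simpa [bd_castChain K _ 0] using h
  have hcc : c = ∑ j, w j • castCycle K (Sing X) ⟨C j, congrFun hC j⟩ := by
    apply Subtype.ext
    rw [AddSubmonoidClass.coe_finsetSum]
    exact hc
  rw [hcc, map_sum]
  refine Submodule.sum_mem _ fun j _ => ?_
  rw [map_smul, ← castH1_homologyClass]
  exact Submodule.smul_mem _ _ (Submodule.subset_span ⟨_, rfl⟩)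

theorem linearIndependent_castH1 {ι : Type*} {v : ι → H1 ℤ X} (hv : LinearIndependent ℤ v) :
    LinearIndependent K fun i => castH1 K X (v i) := by
  classical
  choose z hz using fun i => homologyClass_surjective ℤ (v i)
  rw [linearIndependent_iff']
  intro s a ha
  have h0 : homologyClass K X (∑ i ∈ s, a i • castCycle K (Sing X) (z i)) = 0 := by
    rw [map_sum, ← ha]
    refine Finset.sum_congr rfl fun i _ => ?_
    rw [map_smul, ← castH1_homologyClass, hz]
  obtain ⟨d, hd⟩ := (homologyClass_eq_zero_iff K _).1 h0
  obtain ⟨m, w, κ, hw, hκ0, hκ⟩ :=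
    exists_integral_coordinates (s.image a ∪ d.support.image d)
  have hd' := eq_sum_smul_castChain K hκ0 d fun σ h =>
    hκ _ (Finset.mem_union_right _ (Finset.mem_image_of_mem d h))
  set D : Fin m → (Sing X) _⦋2⦌ →₀ ℤ := fun j => d.mapRange (fun x => κ x j) (congrFun hκ0 j)
  -- Comparing `w j`-coordinates turns a relation over `K` into integral relations among the `v i`,
  -- so every coordinate of every `a i` vanishes.
  have hD : (fun j => bd ℤ (Sing X) 1 (D j)) = fun j => ∑ i ∈ s, κ (a i) j • (z i).1 := by
    apply eq_of_sum_smul_castChain_eq K hw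
    rw [hd', map_sum, AddSubmonoidClass.coe_finsetSum] at hd
    simp only [map_smul] at hd
    refine Eq.trans ?_ (hd.trans ?_)
    · exact Finset.sum_congr rfl fun j _ => congrArg _ (bd_castChain K _ 1 _).symm
    · simp only [map_sum, Finset.smul_sum]
      rw [Finset.sum_comm]
      refine Finset.sum_congr rfl fun i hi => ?_
      change a i • castChain K _ (z i).1 = _
      conv_lhs => rw [hκ (a i) (Finset.mem_union_left _ (Finset.mem_image_of_mem a hi)),
        Finset.sum_smul]
      refine Finset.sum_congr rfl fun j _ => ?_
      rw [map_zsmul, mul_smul, Int.cast_smul_eq_zsmul]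
  intro i hi
  have hκi : ∀ j, κ (a i) j = 0 := fun j => by
    refine linearIndependent_iff'.1 hv s (fun i => κ (a i) j) ?_ i hi
    have : homologyClass ℤ X (∑ i ∈ s, κ (a i) j • z i) = 0 := by
      refine (homologyClass_eq_zero_iff ℤ _).2 ⟨D j, (congrFun hD j).trans ?_⟩
      rw [AddSubmonoidClass.coe_finsetSum]
      rfl
    rw [map_sum] at this
    rw [← this]
    refine Finset.sum_congr rfl fun i _ => ?_
    rw [map_zsmul, hz]
  rw [hκ (a i) (Finset.mem_union_left _ (Finset.mem_image_of_mem a hi))]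
  simp [hκi]

end Scalars

/-! ### The action on the lifted subspace -/

section LiftedSubspace

variable {X E : Type u} [TopologicalSpace X] [TopologicalSpace E] [AddAction ℤ E]

/-- The corestriction of `q_*` to its image. -/
def projRange (k : ℕ) (E : Type u) [TopologicalSpace E] [AddAction ℤ E] :
    H1 ℂ E →ₗ[ℂ] liftedSubspace k E :=
  (h1Map ℂ (proj k E)).rangeRestrict

theorem projRange_surjective (k : ℕ) : Function.Surjective (projRange k E) :=
  (h1Map ℂ (proj k E)).surjective_rangeRestrict

theorem h1Map_descend_proj (k : ℕ) (f : C(E, E)) (hf : ∀ (n : ℤ) (e : E), f (n +ᵥ e) = n +ᵥ f e)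
    (v : H1 ℂ E) :
    h1Map ℂ (descend k f hf) (h1Map ℂ (proj k E) v) = h1Map ℂ (proj k E) (h1Map ℂ f v) := by
  rw [← LinearMap.comp_apply, ← LinearMap.comp_apply, ← h1Map_comp, ← h1Map_comp]
  rfl

theorem h1Map_descend_mem_liftedSubspace (k : ℕ) (f : C(E, E))
    (hf : ∀ (n : ℤ) (e : E), f (n +ᵥ e) = n +ᵥ f e) :
    ∀ v ∈ liftedSubspace k E, h1Map ℂ (descend k f hf) v ∈ liftedSubspace k E := by
  rintro _ ⟨v, rfl⟩
  exact ⟨_, (h1Map_descend_proj k f hf v).symm⟩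

variable [ContinuousConstVAdd ℤ E]

theorem projRange_deck (k : ℕ) (v : H1 ℂ E) :
    projRange k E (h1Map ℂ (deck E k) v) = projRange k E v :=
  Subtype.ext (h1Map_proj_deck ℂ k v)

theorem castH1_T_smul (n : ℤ) (v : H1 ℤ E) :
    castH1 ℂ E ((LaurentPolynomial.T n : ℤ[T;T⁻¹]) • v) =
      h1Map ℂ (deck E n) (castH1 ℂ E v) := by
  rw [T_smul, h1Map_castH1]

theorem projRange_castH1_T_smul (k : ℕ) (v : H1 ℤ E) :
    projRange k E (castH1 ℂ E ((LaurentPolynomial.T (k : ℤ) : ℤ[T;T⁻¹]) • v)) =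
      projRange k E (castH1 ℂ E v) := by
  rw [castH1_T_smul, projRange_deck]

/-! ### Fourier sums over the deck action. -/

/-- The component in the `z`-eigenspace of `T_*`, up to a factor, of the image of a class in
`H_1(E)`, for a `k`-th root of unity `z`. -/
def eigenPart (k : ℕ) (z : ℂˣ) (v : H1 ℤ E) : liftedSubspace k E :=
  ∑ m ∈ Finset.range k, ((z ^ m)⁻¹ : ℂˣ).val •
    projRange k E (castH1 ℂ E ((LaurentPolynomial.T (m : ℤ) : ℤ[T;T⁻¹]) • v))

theorem eigenPart_add (k : ℕ) (z : ℂˣ) (v w : H1 ℤ E) :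
    eigenPart k z (v + w) = eigenPart k z v + eigenPart k z w := by
  simp only [eigenPart, smul_add, map_add, Finset.sum_add_distrib]

/-- `eigenPart` as an additive homomorphism. -/
def eigenPartHom (k : ℕ) (z : ℂˣ) : H1 ℤ E →+ liftedSubspace k E :=
  AddMonoidHom.mk' (eigenPart k z) (eigenPart_add k z)

/-- Applying `t` shifts the summation index by one; the sum is cyclic since `z ^ k = 1` and `q_*`
absorbs `T ^ k`. -/
theorem eigenPart_T_one_smul {k : ℕ} {z : ℂˣ} (hz : z ^ k = 1) (v : H1 ℤ E) :
    eigenPart k z ((LaurentPolynomial.T 1 : ℤ[T;T⁻¹]) • v) = (z : ℂ) • eigenPart k z v := by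
  let x : ℕ → liftedSubspace k E := fun m => ((z ^ m)⁻¹ : ℂˣ).val •
    projRange k E (castH1 ℂ E ((LaurentPolynomial.T (m : ℤ) : ℤ[T;T⁻¹]) • v))
  have hx : x k = x 0 := by
    simp only [x, hz, pow_zero, projRange_castH1_T_smul, Nat.cast_zero, LaurentPolynomial.T_zero,
      one_smul]
  have h1 : eigenPart k z ((LaurentPolynomial.T 1 : ℤ[T;T⁻¹]) • v) =
      (z : ℂ) • ∑ m ∈ Finset.range k, x (m + 1) := by
    rw [eigenPart, Finset.smul_sum]
    refine Finset.sum_congr rfl fun m _ => ?_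
    simp only [x]
    rw [smul_smul, smul_smul, ← LaurentPolynomial.T_add, ← Units.val_mul]
    congr 2
    rw [pow_succ, mul_inv_rev, mul_inv_cancel_left]
  have h2 : ∑ m ∈ Finset.range k, x (m + 1) = ∑ m ∈ Finset.range k, x m := by
    have := (Finset.sum_range_succ' x k).symm.trans (Finset.sum_range_succ x k)
    rw [hx] at this
    exact add_right_cancel this
  rw [h1, h2]
  rfl

theorem eigenPart_T_smul {k : ℕ} {z : ℂˣ} (hz : z ^ k = 1) (n : ℤ) (v : H1 ℤ E) :
    eigenPart k z ((LaurentPolynomial.T n : ℤ[T;T⁻¹]) • v) =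
      (z ^ n : ℂˣ).val • eigenPart k z v := by
  induction n with
  | zero => simp
  | succ n ih =>
    rw [add_comm, LaurentPolynomial.T_add, mul_smul, eigenPart_T_one_smul hz, ih, smul_smul,
      ← Units.val_mul, zpow_add, zpow_one]
  | pred n ih =>
    -- Going down, the one-step rule is applied at the lower exponent and divided by `z`.
    have := eigenPart_T_one_smul hz ((LaurentPolynomial.T (-(n : ℤ) - 1) : ℤ[T;T⁻¹]) • v)
    rw [smul_smul, ← LaurentPolynomial.T_add, add_sub_cancel, ih] at this
    have h2 := congrArg ((z⁻¹ : ℂˣ).val • ·) this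
    simp only [smul_smul, ← Units.val_mul, inv_mul_cancel, Units.val_one, one_smul] at h2
    rw [← h2, zpow_sub_one, mul_comm]

theorem eigenPart_smul {k : ℕ} {z : ℂˣ} (hz : z ^ k = 1) (a : ℤ[T;T⁻¹]) (v : H1 ℤ E) :
    eigenPart k z (a • v) =
      LaurentPolynomial.eval₂ (Int.castRingHom ℂ) z a • eigenPart k z v := by
  induction a using LaurentPolynomial.induction_on' with
  | add p q hp hq => rw [add_smul, eigenPart_add, hp, hq, map_add, add_smul]
  | C_mul_T n c =>
    have hC : ∀ w : H1 ℤ E, (LaurentPolynomial.C c : ℤ[T;T⁻¹]) • w = c • w := fun w => by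
      rw [eq_intCast LaurentPolynomial.C c, Int.cast_smul_eq_zsmul]
    rw [mul_smul, hC, LaurentPolynomial.eval₂_C_mul_T, mul_smul, ← eigenPart_T_smul hz, eq_intCast,
      Int.cast_smul_eq_zsmul]
    exact map_zsmul (eigenPartHom k z) c _

theorem descend_eigenPart (k : ℕ) (z : ℂˣ) (f : C(E, E))
    (hf : ∀ (n : ℤ) (e : E), f (n +ᵥ e) = n +ᵥ f e)
    (hS : ∀ v ∈ liftedSubspace k E, h1Map ℂ (descend k f hf) v ∈ liftedSubspace k E)
    (v : H1 ℤ E) :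
    (h1Map ℂ (descend k f hf)).restrict hS (eigenPart k z v) =
      eigenPart k z (h1MapLaurent f hf v) := by
  rw [eigenPart, eigenPart, map_sum]
  refine Finset.sum_congr rfl fun m _ => ?_
  rw [map_smul]
  congr 1
  apply Subtype.ext
  refine (h1Map_descend_proj k f hf _).trans ?_
  rw [h1Map_castH1]
  exact congrArg (fun w => h1Map ℂ (proj k E) (castH1 ℂ E w)) (laurentAction_comm hf _ v)

theorem geom_sum_of_pow_eq_one {k : ℕ} {u : ℂ} (hu : u ^ k = 1) (h : u ≠ 1) :
    ∑ j ∈ Finset.range k, u ^ j = 0 := by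
  rw [geom_sum_eq h, hu, sub_self, zero_div]

/-- Fourier inversion: after exchanging sums, orthogonality of the powers of `ζ` leaves only the
term `m = 0`. -/
theorem sum_eigenPart {k : ℕ} (hk : 0 < k) {ζ : ℂˣ} (hζ : IsPrimitiveRoot ζ k) (v : H1 ℤ E) :
    ∑ j ∈ Finset.range k, eigenPart k (ζ ^ j) v = (k : ℂ) • projRange k E (castH1 ℂ E v) := by
  simp only [eigenPart]
  rw [Finset.sum_comm, Finset.sum_eq_single 0]
  · simp [Nat.cast_smul_eq_nsmul]
  · intro m hm hm0
    rw [← Finset.sum_smul]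
    have : ∀ j : ℕ, (((ζ ^ j) ^ m)⁻¹ : ℂˣ).val = (((ζ ^ m)⁻¹ : ℂˣ).val) ^ j := fun j => by
      rw [← Units.val_pow_eq_pow_val, inv_pow, ← pow_mul, ← pow_mul, mul_comm]
    simp only [this]
    rw [geom_sum_of_pow_eq_one, zero_smul]
    · rw [← Units.val_pow_eq_pow_val, inv_pow, ← pow_mul, mul_comm, pow_mul, hζ.pow_eq_one]
      simp
    · rw [Ne, Units.val_eq_one, inv_eq_one]
      exact hζ.pow_ne_one_of_pos_of_lt hm0 (Finset.mem_range.1 hm)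
  · intro h
    exact absurd (Finset.mem_range.2 hk) h

/-! ### Bases of `H_1(E; ℂ)` and of the lifted subspace. -/

variable {r : ℕ}

/-- The basis of `H_1(E; ℂ)` over `ℂ` determined by a basis of `H_1(E)` over `ℤ[t, t⁻¹]`. -/
def complexBasis (b : Module.Basis (Fin r) ℤ[T;T⁻¹] (H1 ℤ E)) :
    Module.Basis (ℤ × Fin r) ℂ (H1 ℂ E) :=
  Module.Basis.mk
    (linearIndependent_castH1 ℂ ((AddMonoidAlgebra.basis ℤ ℤ).smulTower b).linearIndependent) <| by
      rw [← span_range_castH1, Submodule.span_le]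
      rintro _ ⟨v, rfl⟩
      have hv : v ∈ Submodule.span ℤ (Set.range ((AddMonoidAlgebra.basis ℤ ℤ).smulTower b)) := by
        rw [Module.Basis.span_eq]
        trivial
      induction hv using Submodule.span_induction with
      | mem x hx =>
        obtain ⟨i, rfl⟩ := hx
        exact Submodule.subset_span ⟨i, rfl⟩
      | zero =>
        rw [map_zero]
        exact zero_mem _
      | add x y _ _ hx hy =>
        rw [map_add]
        exact add_mem hx hy
      | smul a x _ hx =>
        rw [map_zsmul]
        exact zsmul_mem hx a

theorem complexBasis_apply (b : Module.Basis (Fin r) ℤ[T;T⁻¹] (H1 ℤ E)) (n : ℤ) (i : Fin r) :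
    complexBasis b (n, i) = castH1 ℂ E ((LaurentPolynomial.T n : ℤ[T;T⁻¹]) • b i) := by
  rw [complexBasis, Module.Basis.mk_apply, Module.Basis.smulTower_apply]
  simp

/-- The functional extracting the `i`-th coordinate of the specialization at `t = z`. -/
def coordAt (b : Module.Basis (Fin r) ℤ[T;T⁻¹] (H1 ℤ E)) (z : ℂˣ) (i : Fin r) :
    H1 ℂ E →ₗ[ℂ] ℂ :=
  (complexBasis b).constr ℂ fun x => if x.2 = i then (z ^ x.1 : ℂˣ).val else 0

theorem coordAt_apply (b : Module.Basis (Fin r) ℤ[T;T⁻¹] (H1 ℤ E)) (z : ℂˣ) (i i' : Fin r) (n : ℤ) :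
    coordAt b z i (castH1 ℂ E ((LaurentPolynomial.T n : ℤ[T;T⁻¹]) • b i')) =
      if i' = i then (z ^ n : ℂˣ).val else 0 := by
  rw [← complexBasis_apply, coordAt, Module.Basis.constr_basis]

/-- `T ^ k` multiplies the value by `z ^ k = 1`; hence the functional vanishes on the kernel of
`q_*`. -/
theorem coordAt_deck (b : Module.Basis (Fin r) ℤ[T;T⁻¹] (H1 ℤ E)) {k : ℕ} {z : ℂˣ}
    (hz : z ^ k = 1) (i : Fin r) (v : H1 ℂ E) :
    coordAt b z i (h1Map ℂ (deck E k) v) = coordAt b z i v := by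
  suffices (coordAt b z i).comp (h1Map ℂ (deck E k)) = coordAt b z i from
    LinearMap.congr_fun this v
  refine (complexBasis b).ext fun ⟨n, i'⟩ => ?_
  rw [LinearMap.comp_apply, complexBasis_apply, ← castH1_T_smul, smul_smul,
    ← LaurentPolynomial.T_add, coordAt_apply, coordAt_apply, zpow_add, zpow_natCast, hz, one_mul]

/-- The functionals `coordAt` at powers of `ζ` form, up to the factor `k`, a dual family. -/
theorem linearIndependent_eigenPart {p : E → X} (hp : IsAddQuotientCoveringMap p ℤ)
    (b : Module.Basis (Fin r) ℤ[T;T⁻¹] (H1 ℤ E)) {k : ℕ} (hk : 0 < k) {ζ : ℂˣ}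
    (hζ : IsPrimitiveRoot ζ k) :
    LinearIndependent ℂ fun x : Fin r × Fin k => eigenPart k (ζ ^ (x.2 : ℕ)) (b x.1) := by
  rw [Fintype.linearIndependent_iff]
  rintro a ha ⟨i, j⟩
  let u : Fin r × Fin k → H1 ℂ E := fun x => ∑ m ∈ Finset.range k,
    (((ζ ^ (x.2 : ℕ)) ^ m)⁻¹ : ℂˣ).val •
      castH1 ℂ E ((LaurentPolynomial.T (m : ℤ) : ℤ[T;T⁻¹]) • b x.1)
  have hu : ∀ x, projRange k E (u x) = eigenPart k (ζ ^ (x.2 : ℕ)) (b x.1) := fun x => by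
    simp only [u, map_sum, map_smul, eigenPart]
  have h0 : projRange k E (∑ x, a x • u x) = 0 := by
    simp only [map_sum, map_smul, hu, ha]
  -- A relation in the image lifts to an element of the image of `T ^ k - 1`, which `coordAt` kills.
  obtain ⟨w, hw⟩ := (h1Map_proj_eq_zero_iff ℂ hp hk _).1 (congrArg Subtype.val h0)
  have hroot : ∀ j : ℕ, (ζ ^ j) ^ k = 1 := fun j => by
    rw [← pow_mul, mul_comm, pow_mul, hζ.pow_eq_one, one_pow]
  have hc : coordAt b (ζ ^ (j : ℕ)) i (∑ x, a x • u x) = 0 := by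
    rw [← hw, map_sub, coordAt_deck b (hroot j), sub_self]
  have huv : ∀ x, coordAt b (ζ ^ (j : ℕ)) i (u x) = if x = (i, j) then (k : ℂ) else 0 := by
    rintro ⟨i', j'⟩
    simp only [u, map_sum, map_smul, coordAt_apply, smul_eq_mul, zpow_natCast]
    by_cases hi : i' = i
    · subst hi
      have : ∀ m : ℕ, (((ζ ^ (j' : ℕ)) ^ m)⁻¹ : ℂˣ).val * ((ζ ^ (j : ℕ)) ^ m : ℂˣ).val =
          (((ζ ^ (j' : ℕ))⁻¹ * ζ ^ (j : ℕ) : ℂˣ).val) ^ m := fun m => by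
        rw [← Units.val_mul, ← Units.val_pow_eq_pow_val, mul_pow, inv_pow]
      simp only [if_true, this]
      by_cases hj : j' = j
      · subst hj
        simp
      · rw [if_neg (by simpa using hj), geom_sum_of_pow_eq_one]
        · rw [← Units.val_pow_eq_pow_val, mul_pow, inv_pow, hroot, hroot]
          simp
        · rw [Ne, Units.val_eq_one, inv_mul_eq_one]
          exact fun h => hj (Fin.ext (hζ.pow_inj j'.2 j.2 h))
    · simp [hi]
  rw [map_sum, Finset.sum_eq_single (i, j)] at hc
  · rw [map_smul, huv, if_pos rfl, smul_eq_mul] at hc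
    exact (mul_eq_zero.1 hc).resolve_right (by exact_mod_cast hk.ne')
  · intro x _ hx
    rw [map_smul, huv, if_neg hx, smul_zero]
  · simp

/-- Fourier inversion writes the image of `T ^ n b_i` as `1 / k` times a sum of eigenparts, on which
`T ^ n` is a scalar. -/
theorem span_eigenPart (b : Module.Basis (Fin r) ℤ[T;T⁻¹] (H1 ℤ E)) {k : ℕ} (hk : 0 < k) {ζ : ℂˣ}
    (hζ : IsPrimitiveRoot ζ k) :
    ⊤ ≤ Submodule.span ℂ
      (Set.range fun x : Fin r × Fin k => eigenPart k (ζ ^ (x.2 : ℕ)) (b x.1)) := by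
  rw [← LinearMap.range_eq_top.2 (projRange_surjective k), LinearMap.range_eq_map,
    ← (complexBasis b).span_eq, Submodule.map_span_le]
  rintro _ ⟨⟨n, i⟩, rfl⟩
  have hk' : (k : ℂ) ≠ 0 := by exact_mod_cast hk.ne'
  rw [complexBasis_apply, ← inv_smul_smul₀ hk' (projRange k E _), ← sum_eigenPart hk hζ]
  refine Submodule.smul_mem _ _ (Submodule.sum_mem _ fun j hj => ?_)
  rw [eigenPart_T_smul]
  · exact Submodule.smul_mem _ _ (Submodule.subset_span ⟨(i, ⟨j, Finset.mem_range.1 hj⟩), rfl⟩)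
  · rw [← pow_mul, mul_comm, pow_mul, hζ.pow_eq_one, one_pow]

theorem isPrimitiveRoot_eta {k : ℕ} (hk : 0 < k) : IsPrimitiveRoot (eta k) k :=
  IsPrimitiveRoot.coe_units_iff.1 (Complex.isPrimitiveRoot_exp k hk.ne')

theorem exists_basis_toMatrix_eq_blockDiagonal {p : E → X} (hp : IsAddQuotientCoveringMap p ℤ)
    (f : C(E, E)) (hf : ∀ (n : ℤ) (e : E), f (n +ᵥ e) = n +ᵥ f e) {k : ℕ} (hk : 0 < k)
    (hS : ∀ v ∈ liftedSubspace k E, h1Map ℂ (descend k f hf) v ∈ liftedSubspace k E)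
    (b : Module.Basis (Fin r) ℤ[T;T⁻¹] (H1 ℤ E)) :
    ∃ β : Module.Basis (Fin r × Fin k) ℂ (liftedSubspace k E),
      LinearMap.toMatrix β β ((h1Map ℂ (descend k f hf)).restrict hS) =
        Matrix.blockDiagonal fun j : Fin k =>
          substitute (LinearMap.toMatrix b b (h1MapLaurent f hf)) (eta k ^ (j : ℕ)) := by
  have hζ := isPrimitiveRoot_eta hk
  let β := Module.Basis.mk (linearIndependent_eigenPart hp b hk hζ) (span_eigenPart b hk hζ)
  have hβ : ∀ x, β x = eigenPart k (eta k ^ (x.2 : ℕ)) (b x.1) := fun x =>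
    Module.Basis.mk_apply _ _ x
  refine ⟨β, ?_⟩
  ext ⟨i, j⟩ ⟨i', j'⟩
  have hroot : (eta k ^ (j' : ℕ)) ^ k = 1 := by
    rw [← pow_mul, mul_comm, pow_mul, hζ.pow_eq_one, one_pow]
  have key : (h1Map ℂ (descend k f hf)).restrict hS (β (i', j')) =
      ∑ l, substitute (LinearMap.toMatrix b b (h1MapLaurent f hf)) (eta k ^ (j' : ℕ)) l i' •
        β (l, j') := by
    rw [hβ, descend_eigenPart, ← b.sum_repr (h1MapLaurent f hf (b i'))]
    refine (map_sum (eigenPartHom k (eta k ^ (j' : ℕ))) _ _).trans ?_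
    refine Finset.sum_congr rfl fun l _ => ?_
    rw [hβ]
    refine (eigenPart_smul hroot _ _).trans ?_
    rw [substitute, Matrix.map_apply, LinearMap.toMatrix_apply]
  rw [LinearMap.toMatrix_apply, key, Matrix.blockDiagonal_apply, map_sum, Finsupp.finsetSum_apply]
  simp only [map_smul, Module.Basis.repr_self, Finsupp.smul_apply, Finsupp.single_apply,
    Prod.mk.injEq, smul_eq_mul, mul_ite, mul_one, mul_zero]
  by_cases hj : j = j'
  · subst hj
    simp
  · rw [if_neg hj]
    exact Finset.sum_eq_zero fun l _ => if_neg fun h => hj h.2.symm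

/-- The inverse homeomorphism also commutes with the deck group, so it induces an `R`-linear
inverse. -/
theorem isUnit_toMatrix_h1MapLaurent (f : E ≃ₜ E)
    (hf : ∀ (n : ℤ) (e : E), (f : C(E, E)) (n +ᵥ e) = n +ᵥ (f : C(E, E)) e)
    (b : Module.Basis (Fin r) ℤ[T;T⁻¹] (H1 ℤ E)) :
    IsUnit (LinearMap.toMatrix b b (h1MapLaurent (f : C(E, E)) hf)) := by
  have hg : ∀ (n : ℤ) (e : E), (f.symm : C(E, E)) (n +ᵥ e) = n +ᵥ (f.symm : C(E, E)) e := by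
    intro n e
    apply f.injective
    change f (f.symm (n +ᵥ e)) = (f : C(E, E)) (n +ᵥ f.symm e)
    rw [hf, f.apply_symm_apply]
    change _ = n +ᵥ f (f.symm e)
    rw [f.apply_symm_apply]
  have hinv : ∀ g g' : C(E, E), g.comp g' = ContinuousMap.id E →
      ∀ v, h1Map ℤ g (h1Map ℤ g' v) = v := by
    intro g g' h v
    rw [← LinearMap.comp_apply, ← h1Map_comp, h, h1Map_id]
    rfl
  have hu : IsUnit (M := Module.End ℤ[T;T⁻¹] (H1 ℤ E)) (h1MapLaurent (f : C(E, E)) hf) :=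
    ⟨⟨h1MapLaurent (f : C(E, E)) hf, h1MapLaurent (f.symm : C(E, E)) hg,
      LinearMap.ext (hinv _ _ (ContinuousMap.ext f.apply_symm_apply)),
      LinearMap.ext (hinv _ _ (ContinuousMap.ext f.symm_apply_apply))⟩, rfl⟩
  exact hu.map (LinearMap.toMatrixAlgEquiv b)

end LiftedSubspace

/-! ### Eigenvalues on the quotient -/

/-- The two memberships put `(μ ^ N - 1) • v` in `W`, while `v` is not in `W`. Working modulo `W`
lets this serve both eigenvectors outside `W` and eigenvectors of the quotient map. -/
theorem pow_eq_one_of_pow_apply_sub_mem {V : Type*} [AddCommGroup V] [Module ℂ V]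
    {W : Submodule ℂ V} {f : V →ₗ[ℂ] V} {N : ℕ} (h : ∀ v, (f ^ N) v - v ∈ W) {μ : ℂ} {v : V}
    (hv : (f ^ N) v - μ ^ N • v ∈ W) (hvW : v ∉ W) : μ ^ N = 1 := by
  by_contra hμ
  have h1 := sub_mem (h v) hv
  rw [sub_sub_sub_cancel_left, show μ ^ N • v - v = (μ ^ N - 1) • v by rw [sub_smul, one_smul]]
    at h1
  exact hvW ((W.smul_mem_iff (sub_ne_zero.2 hμ)).1 h1)

theorem pow_apply_sub_smul_mem {V : Type*} [AddCommGroup V] [Module ℂ V]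
    {W : Submodule ℂ V} {f : V →ₗ[ℂ] V} (hf : ∀ v ∈ W, f v ∈ W) {μ : ℂ} {v : V}
    (hv : f v - μ • v ∈ W) (N : ℕ) : (f ^ N) v - μ ^ N • v ∈ W := by
  induction N with
  | zero => simp
  | succ N ih =>
    have h1 := add_mem (hf _ ih) (W.smul_mem (μ ^ N) hv)
    rw [map_sub, map_smul, smul_sub, sub_add_sub_cancel, smul_smul, ← pow_succ] at h1
    rwa [pow_succ', Module.End.mul_apply]

end CyclicCover

end

theorem mainTheorem4 {X E : Type u} [TopologicalSpace X] [LocallyPathConnectedSpace X]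
    (hX : CyclicCover.SemilocallySimplyConnected X)
    [Module.Free ℤ (CyclicCover.H1 ℤ X)] [Module.Finite ℤ (CyclicCover.H1 ℤ X)]
    (h : X ≃ₜ X) (ρ : CyclicCover.H1 ℤ X →+ ℤ)
    (hρ : ∀ a, ρ (CyclicCover.h1Map ℤ (h : C(X, X)) a) = ρ a)
    [TopologicalSpace E] [AddAction ℤ E] [ContinuousConstVAdd ℤ E] (p : E → X)
    (hp : CyclicCover.IsCoverAssociatedTo p ρ)
    (hinf : E ≃ₜ E) (hlift : ∀ e, p (hinf e) = h (p e))
    (hcomm : ∀ (n : ℤ) (e : E), (hinf : C(E, E)) (n +ᵥ e) = n +ᵥ (hinf : C(E, E)) e)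
    (k : ℕ) (hk : 0 < k) :
    ∃ hS : ∀ v ∈ CyclicCover.liftedSubspace k E,
        CyclicCover.h1Map ℂ (CyclicCover.descend k (hinf : C(E, E)) hcomm) v ∈
          CyclicCover.liftedSubspace k E,
      (∀ (r : ℕ) (b : Module.Basis (Fin r) ℤ[T;T⁻¹] (CyclicCover.H1 ℤ E))
          (M : Matrix (Fin r) (Fin r) ℤ[T;T⁻¹]),
        M = LinearMap.toMatrix b b (CyclicCover.h1MapLaurent (hinf : C(E, E)) hcomm) →
        IsUnit M ∧
        ∃ β : Module.Basis (Fin r × Fin k) ℂ (CyclicCover.liftedSubspace k E),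
          LinearMap.toMatrix β β
              ((CyclicCover.h1Map ℂ (CyclicCover.descend k (hinf : C(E, E)) hcomm)).restrict hS) =
            Matrix.blockDiagonal fun j : Fin k =>
              CyclicCover.substitute M (CyclicCover.eta k ^ (j : ℕ))) ∧
      (∀ (μ : ℂ) (v : CyclicCover.H1 ℂ (CyclicCover.CyclicQuotient k E)),
        Module.End.HasEigenvector
          (CyclicCover.h1Map ℂ (CyclicCover.descend k (hinf : C(E, E)) hcomm)) μ v →
        v ∉ CyclicCover.liftedSubspace k E → ∃ n : ℕ, 0 < n ∧ μ ^ n = 1) ∧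
      (∀ μ : ℂ,
        Module.End.HasEigenvalue
          ((CyclicCover.liftedSubspace k E).mapQ (CyclicCover.liftedSubspace k E)
            (CyclicCover.h1Map ℂ (CyclicCover.descend k (hinf : C(E, E)) hcomm)) hS) μ →
        ∃ n : ℕ, 0 < n ∧ μ ^ n = 1) := by
  -- A single exponent `N` works for all eigenvalues in both statements about roots of unity.
  obtain ⟨N, hN, hNS⟩ :=
    CyclicCover.exists_pow_h1Map_descend_sub_mem_range ℂ hp hinf hcomm hk
  have hS := CyclicCover.h1Map_descend_mem_liftedSubspace k (hinf : C(E, E)) hcomm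
  refine ⟨hS, ?_, ?_, ?_⟩
  · rintro r b M rfl
    exact ⟨CyclicCover.isUnit_toMatrix_h1MapLaurent hinf hcomm b,
      CyclicCover.exists_basis_toMatrix_eq_blockDiagonal hp.toIsAddQuotientCoveringMap
        (hinf : C(E, E)) hcomm hk hS b⟩
  · intro μ v hv hvS
    refine ⟨N, hN, CyclicCover.pow_eq_one_of_pow_apply_sub_mem hNS
      (CyclicCover.pow_apply_sub_smul_mem hS ?_ N) hvS⟩
    rw [hv.apply_eq_smul, sub_self]
    exact zero_mem _
  · intro μ hμ
    obtain ⟨w, hw⟩ := hμ.exists_hasEigenvector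
    obtain ⟨v, rfl⟩ := Submodule.mkQ_surjective _ w
    refine ⟨N, hN, CyclicCover.pow_eq_one_of_pow_apply_sub_mem (v := v) hNS
      (CyclicCover.pow_apply_sub_smul_mem hS ?_ N) fun hvS => hw.2 ?_⟩
    · rw [← Submodule.Quotient.mk_eq_zero, Submodule.Quotient.mk_sub, sub_eq_zero]
      exact hw.apply_eq_smul
    · exact (Submodule.Quotient.mk_eq_zero _).2 hvS
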